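/- Let $w=(w(n))_{n\ge 0}$ be a non-decreasing sequence of positive real numbers with $\sum_{n} 1/w(n)^2<\infty$ and $\sum_n 1/w(n)=\infty$. Extend $w$ to $\mathbb{R}_+$ by $w(t)=w(\lfloor t\rfloor)$ and set $W(t)=\int_0^t \frac{du}{w(u)}$. Fix $-\infty\le a<0<b\le\infty$ and an initial local time configuration $\mathcal{C}=(z_0(y))_{y\in\mathbb{Z}}$ with values in $\{0,1,2,\dots\}$. Let $\bar X=(\bar X_n)_{n\ge 0}$ be a $\mathcal{C}$-vertex reinforced random walk with weight $w$ on $[\![a,b]\!]=\{x\in\mathbb{Z}: a\le x\le b\}$, that is, a nearest neighbour process on $[\![a,b]\!]$ with $\bar X_0=0$ such that, with $\bar Z_n(y)=z_0(y)+\sum_{k=0}^n 1_{\{\bar X_k=y\}}$ and $\mathcal{F}_n=\sigma(\bar X_0,\dots,\bar X_n)$, on the event $\{\bar X_n=x\}$, $$\mathbb{P}\{\bar X_{n+1}=x\pm 1\mid\mathcal{F}_n\}=\frac{w(\bar Z_n(x\pm 1))}{w(\bar Z_n(x+1))+w(\bar Z_n(x-1))}\qquad\text{if } a<x<b,$$ while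 the walk is reflected at the finite end points: from $a$ (resp. $b$), if finite, it jumps to $a+1$ (resp. $b-1$) with probability $1$. Let $\bar Z_\infty(0)=\lim_n\bar Z_n(0)$ and let $\delta:=\lim_{n\to\infty}\big(W(\bar Z_n(1))-W(\bar Z_n(-1))\big)$ when this limit exists. Then, for every $\delta_0\in\mathbb{R}$, $$\mathbb{P}\big(\{\delta\text{ exists and equals }\delta_0\}\cap\{\bar Z_\infty(0)=\infty\}\big)=0.$$ -/

import Mathlib

open MeasureTheory ProbabilityTheory Filter Topology

namespace VRRW

/-- The function `W(t) = ∫₀ᵗ du / w(u)`, where the weight sequence `w` is extended to real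
arguments by `w(u) = w(⌊u⌋)`. -/
noncomputable def W (w : ℕ → ℝ) (t : ℝ) : ℝ :=
  ∫ u in (0 : ℝ)..t, 1 / w ⌊u⌋₊

/-- The integer interval with end points `a` (possibly `-∞`) and `b` (possibly `+∞`). -/
def interval (a : WithBot ℤ) (b : WithTop ℤ) : Set ℤ :=
  {x | a ≤ (x : WithBot ℤ) ∧ (x : WithTop ℤ) ≤ b}

section Walk

variable {Ω : Type*}

/-- The local time `Z_n(y) = z₀(y) + ∑_{k=0}^n 1_{X_k = y}`, started from the initial local time
configuration `z₀`. -/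
def localTime (z₀ : ℤ → ℕ) (X : ℕ → Ω → ℤ) (n : ℕ) (y : ℤ) (ω : Ω) : ℕ :=
  z₀ y + ∑ k ∈ Finset.range (n + 1), if X k ω = y then 1 else 0

open Classical in
/-- The weight that attracts the walk to the site `y` at time `n`: it is `w (Z_n(y))` if `y` belongs
to the set `I` of allowed sites, and `0` otherwise (reflection at the boundary of `I`). -/
noncomputable def attraction (w : ℕ → ℝ) (z₀ : ℤ → ℕ) (I : Set ℤ) (X : ℕ → Ω → ℤ) (n : ℕ) (y : ℤ)
    (ω : Ω) : ℝ :=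
  if y ∈ I then w (localTime z₀ X n y ω) else 0

/-- `X` is, under `P`, a vertex reinforced random walk with weight sequence `w`, restricted to the
set of sites `I` and with initial local time configuration `z₀`: it starts from `0`, and given the
natural filtration at time `n` it jumps from its position `X_n = x` to each of the two neighbours
`x + 1` and `x - 1` with probability proportional to the attraction of that neighbour. -/
structure IsVRRW [MeasurableSpace Ω] (P : Measure Ω) (w : ℕ → ℝ) (z₀ : ℤ → ℕ) (I : Set ℤ)
    (X : ℕ → Ω → ℤ) : Prop where
  stronglyMeasurable : ∀ n, StronglyMeasurable (X n)
  start : ∀ᵐ ω ∂P, X 0 ω = 0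
  step_right : ∀ n, P⟦{ω | X (n + 1) ω = X n ω + 1} | Filtration.natural X stronglyMeasurable n⟧
    =ᵐ[P] fun ω => attraction w z₀ I X n (X n ω + 1) ω /
      (attraction w z₀ I X n (X n ω + 1) ω + attraction w z₀ I X n (X n ω - 1) ω)
  step_left : ∀ n, P⟦{ω | X (n + 1) ω = X n ω - 1} | Filtration.natural X stronglyMeasurable n⟧
    =ᵐ[P] fun ω => attraction w z₀ I X n (X n ω - 1) ω /
      (attraction w z₀ I X n (X n ω + 1) ω + attraction w z₀ I X n (X n ω - 1) ω)

end Walk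

/-- At integers, the function `W` is a partial sum of the series `∑ 1 / w(k)`. -/
theorem W_natCast (w : ℕ → ℝ) (n : ℕ) : W w n = ∑ k ∈ Finset.range n, 1 / w k := by
  have key : ∀ k : ℕ, ∀ u ∈ Set.Ioo (k : ℝ) ((k + 1 : ℕ) : ℝ), 1 / w ⌊u⌋₊ = 1 / w k := by
    intro k u hu
    have : ⌊u⌋₊ = k := by
      rw [Nat.floor_eq_iff (le_trans (Nat.cast_nonneg k) hu.1.le)]
      exact ⟨hu.1.le, by simpa using hu.2⟩
    rw [this]
  have hle : ∀ k : ℕ, (k : ℝ) ≤ ((k + 1 : ℕ) : ℝ) := fun k => by simp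
  have hint : ∀ k : ℕ, IntervalIntegrable (fun u : ℝ => 1 / w ⌊u⌋₊) volume (k : ℝ)
      ((k + 1 : ℕ) : ℝ) := by
    intro k
    rw [intervalIntegrable_iff_integrableOn_Ioo_of_le (hle k)]
    exact (integrableOn_const (C := 1 / w k) (by simp)).congr_fun (fun u hu => (key k u hu).symm)
      measurableSet_Ioo
  have hval : ∀ k : ℕ, ∫ u in (k : ℝ)..((k + 1 : ℕ) : ℝ), 1 / w ⌊u⌋₊ = 1 / w k := by
    intro k
    rw [intervalIntegral.integral_of_le (hle k), integral_Ioc_eq_integral_Ioo,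
      setIntegral_congr_fun measurableSet_Ioo (key k)]
    simp
  have h := intervalIntegral.sum_integral_adjacent_intervals (f := fun u : ℝ => 1 / w ⌊u⌋₊)
    (μ := volume) (a := fun k : ℕ => (k : ℝ)) (n := n) (fun k _ => hint k)
  rw [Finset.sum_congr rfl (fun k _ => hval k)] at h
  simpa [W] using h.symm

end VRRW

/-! The walk is realised with independent exponential clocks. A site other than `0` carries a fresh
pair of clocks for each of its visits. At `0` the clocks are run as in Rubin's construction: an
excursion to the left does not change the local time of `1`, so the clock of the next jump to the
right keeps its residual time and can be read against the total time spent at `0` (`clock`). By lack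
of memory (`lintegral_race_residual`) the path so built has the law of the reinforced walk
(`clockLaw_run`, `IsVRRW.map_eq`).

Freeze all clocks except the first one for the jumps from `0` to the right, and let `p`, `p'` be the
paths for two values of it, the shorter one for `p'`. The path `p'` is pushed to the right: away
from `0` its arrows dominate those of `p` (`Coupled.arrowLE`), and at `0` its right clock is ahead
by a fixed `D > 0`. Measuring time by the time spent at `0`, at time `s` the path `p'` has visited
`1` at least as often as `p` at time `s + D`, and `-1` at most as often as `p` at time `s`.

Let `S` be the partial sums of `1 / w`, which are the values of `W` at integers. If both paths had
the same limit `δ`, the increments over `[s, s + D]` of `S` at the local time of `-1` for `p` would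
have nonpositive upper limit, so this potential would grow sublinearly in `s`. But averages of
exponential clocks are bounded, so time `s` at the origin costs a potential of at least `s / C` up
to a constant (`clock_le_mul_sum`). This contradiction is `Coupled.not_both_tendsto`.

Hence, the other clocks being fixed, at most one value of the first clock yields `δ₀`. The
exponential law has no atoms, and Fubini concludes (`clockLaw_limitEvent`). -/

namespace VRRW

/-! ### Nearest neighbour paths -/

/-- A nearest neighbour path on `ℤ` started from `0`. -/
structure IsPath (p : ℕ → ℤ) : Prop where
  start : p 0 = 0
  step : ∀ n, p (n + 1) = p n + 1 ∨ p (n + 1) = p n - 1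

/-- The number of visits of `p` to `x` before time `n`. -/
def visits (p : ℕ → ℤ) (n : ℕ) (x : ℤ) : ℕ := Nat.count (fun m => p m = x) n

/-- The number of jumps of `p` from `x` to `x + 1` before time `n`. -/
def rightJumps (p : ℕ → ℤ) (n : ℕ) (x : ℤ) : ℕ :=
  Nat.count (fun m => p m = x ∧ p (m + 1) = x + 1) n

/-- The number of jumps of `p` from `x` to `x - 1` before time `n`. -/
def leftJumps (p : ℕ → ℤ) (n : ℕ) (x : ℤ) : ℕ :=
  Nat.count (fun m => p m = x ∧ p (m + 1) = x - 1) n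

theorem IsPath.neg {p : ℕ → ℤ} (h : IsPath p) : IsPath (-p) := by
  refine ⟨by simp [h.start], fun n => ?_⟩
  have := h.step n
  simp only [Pi.neg_apply]
  omega

theorem visits_neg (p : ℕ → ℤ) (n : ℕ) (x : ℤ) : visits (-p) n x = visits p n (-x) := by
  unfold visits
  congr 1
  ext m
  simp [neg_eq_iff_eq_neg]

theorem rightJumps_neg (p : ℕ → ℤ) (n : ℕ) (x : ℤ) : rightJumps (-p) n x = leftJumps p n (-x) := by
  unfold rightJumps leftJumps
  congr 1
  ext m
  simp only [Pi.neg_apply]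
  constructor <;> rintro ⟨h1, h2⟩ <;> constructor <;> omega

theorem leftJumps_neg (p : ℕ → ℤ) (n : ℕ) (x : ℤ) : leftJumps (-p) n x = rightJumps p n (-x) := by
  unfold rightJumps leftJumps
  congr 1
  ext m
  simp only [Pi.neg_apply]
  constructor <;> rintro ⟨h1, h2⟩ <;> constructor <;> omega

theorem visits_mono (p : ℕ → ℤ) (x : ℤ) : Monotone fun n => visits p n x := Nat.count_monotone _

theorem rightJumps_mono (p : ℕ → ℤ) (x : ℤ) : Monotone fun n => rightJumps p n x :=
  Nat.count_monotone _

theorem leftJumps_mono (p : ℕ → ℤ) (x : ℤ) : Monotone fun n => leftJumps p n x :=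
  Nat.count_monotone _

theorem visits_succ (p : ℕ → ℤ) (n : ℕ) (x : ℤ) :
    visits p (n + 1) x = visits p n x + if p n = x then 1 else 0 := Nat.count_succ ..

theorem rightJumps_succ (p : ℕ → ℤ) (n : ℕ) (x : ℤ) :
    rightJumps p (n + 1) x = rightJumps p n x + if p n = x ∧ p (n + 1) = x + 1 then 1 else 0 :=
  Nat.count_succ ..

theorem leftJumps_succ (p : ℕ → ℤ) (n : ℕ) (x : ℤ) :
    leftJumps p (n + 1) x = leftJumps p n x + if p n = x ∧ p (n + 1) = x - 1 then 1 else 0 :=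
  Nat.count_succ ..

@[simp] theorem visits_zero (p : ℕ → ℤ) (x : ℤ) : visits p 0 x = 0 := Nat.count_zero _

@[simp] theorem rightJumps_zero (p : ℕ → ℤ) (x : ℤ) : rightJumps p 0 x = 0 := Nat.count_zero _

@[simp] theorem leftJumps_zero (p : ℕ → ℤ) (x : ℤ) : leftJumps p 0 x = 0 := Nat.count_zero _

theorem _root_.Nat.exists_of_lt_count {P : ℕ → Prop} [DecidablePred P] {k n : ℕ}
    (h : k < Nat.count P n) : ∃ m < n, P m ∧ Nat.count P m = k := by
  have hk : ∀ hf : (Set.ofPred P).Finite, k < hf.toFinset.card := fun hf =>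
    h.trans_le (Nat.count_le_card hf n)
  exact ⟨Nat.nth P k, Nat.nth_lt_of_lt_count h, Nat.nth_mem k hk, Nat.count_nth hk⟩

theorem exists_visit {p : ℕ → ℤ} {n k : ℕ} {x : ℤ} (h : k < visits p n x) :
    ∃ m < n, p m = x ∧ visits p m x = k := Nat.exists_of_lt_count h

theorem exists_rightJump {p : ℕ → ℤ} {n k : ℕ} {x : ℤ} (h : k < rightJumps p n x) :
    ∃ m < n, (p m = x ∧ p (m + 1) = x + 1) ∧ rightJumps p m x = k := Nat.exists_of_lt_count h

theorem exists_leftJump {p : ℕ → ℤ} {n k : ℕ} {x : ℤ} (h : k < leftJumps p n x) :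
    ∃ m < n, (p m = x ∧ p (m + 1) = x - 1) ∧ leftJumps p m x = k := Nat.exists_of_lt_count h

theorem IsPath.visits_eq {p : ℕ → ℤ} (hp : IsPath p) (n : ℕ) (x : ℤ) :
    visits p n x = rightJumps p n x + leftJumps p n x := by
  induction n with
  | zero => simp
  | succ n ih =>
    rw [visits_succ, rightJumps_succ, leftJumps_succ, ih]
    have := hp.step n
    split_ifs <;> omega

/-- Up-crossings and down-crossings of an edge to the right of the origin alternate. -/
theorem IsPath.flow {p : ℕ → ℤ} (hp : IsPath p) {x : ℤ} (hx : 0 ≤ x) (n : ℕ) :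
    rightJumps p n x = leftJumps p n (x + 1) + if x + 1 ≤ p n then 1 else 0 := by
  induction n with
  | zero => rw [hp.start]; simp; omega
  | succ n ih =>
    rw [rightJumps_succ, leftJumps_succ, ih]
    have := hp.step n
    split_ifs <;> omega

theorem IsPath.flow_of_le {p : ℕ → ℤ} (hp : IsPath p) {x : ℤ} (hx : 0 ≤ x) {n : ℕ} (h : p n ≤ x) :
    rightJumps p n x = leftJumps p n (x + 1) := by
  rw [hp.flow hx, if_neg (by omega), add_zero]

theorem IsPath.flow_of_lt {p : ℕ → ℤ} (hp : IsPath p) {x : ℤ} (hx : 0 ≤ x) {n : ℕ} (h : x < p n) :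
    rightJumps p n x = leftJumps p n (x + 1) + 1 := by
  rw [hp.flow hx, if_pos (by omega)]

/-! ### Comparison of two paths -/

/-- Away from the origin, whenever `p` jumps to the right at its `k`-th visit to a site, so does
`p'` at its `k`-th visit to the same site; here `p` is looked at before time `n` and `p'` before
time `n'`. -/
def ArrowLE (p p' : ℕ → ℤ) (n n' : ℕ) : Prop :=
  ∀ m < n, ∀ m' < n', p m = p' m' → p m ≠ 0 → visits p m (p m) = visits p' m' (p m) →
    p (m + 1) = p m + 1 → p' (m' + 1) = p' m' + 1

theorem ArrowLE.mono {p p' : ℕ → ℤ} {n n' k k' : ℕ} (h : ArrowLE p p' n n') (hk : k ≤ n)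
    (hk' : k' ≤ n') : ArrowLE p p' k k' :=
  fun m hm m' hm' => h m (hm.trans_le hk) m' (hm'.trans_le hk')

/-- Reflection also exchanges the two paths: since every step is `1` or `-1`, the contrapositive of
the rule for right jumps is the rule for left jumps. Statements about the right half-line thus
transfer to the left one. -/
theorem ArrowLE.neg {p p' : ℕ → ℤ} {n n' : ℕ} (hp : IsPath p) (hp' : IsPath p')
    (h : ArrowLE p p' n n') : ArrowLE (-p') (-p) n' n := by
  intro m hm m' hm' h1 h2 h3 h4
  simp only [Pi.neg_apply, visits_neg, neg_neg] at h1 h2 h3 h4 ⊢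
  have h5 : p m' = p' m := by omega
  have := h m' hm' m hm h5 (by omega) (by rw [h5, h3])
  have := hp.step m'
  have := hp'.step m
  omega

/-- Each visit of `p` to `x` has a counterpart of the same rank in `p'`, and the arrow rule carries
a right jump over to it. -/
theorem ArrowLE.rightJumps_le {p p' : ℕ → ℤ} {n n' : ℕ} (h : ArrowLE p p' n n') {x : ℤ}
    (hx : x ≠ 0) (hv : visits p n x ≤ visits p' n' x) :
    rightJumps p n x ≤ rightJumps p' n' x := by
  induction n generalizing n' with
  | zero => simp
  | succ n ih =>
    rw [visits_succ] at hv
    rw [rightJumps_succ]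
    by_cases hn : p n = x
    · rw [if_pos hn] at hv
      obtain ⟨m', hm', hpm', hvm'⟩ := exists_visit (p := p') (n := n') (k := visits p n x) (x := x)
        (by omega)
      have h1 := ih (h.mono n.le_succ hm'.le) (by omega)
      have h2 := rightJumps_mono p' x (Nat.succ_le_of_lt hm')
      simp only [Nat.succ_eq_add_one] at h2
      rw [rightJumps_succ] at h2
      have h3 := h n n.lt_succ_self m' hm' (by omega) (by omega) (by rw [hn, hvm'])
      split_ifs at h2 ⊢ <;> omega
    · rw [if_neg hn] at hv
      rw [if_neg (by tauto)]
      exact ih (h.mono n.le_succ le_rfl) (by omega)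

theorem ArrowLE.leftJumps_le {p p' : ℕ → ℤ} {n n' : ℕ} (hp : IsPath p) (hp' : IsPath p')
    (h : ArrowLE p p' n n') {x : ℤ} (hx : x ≠ 0) (hv : visits p' n' x ≤ visits p n x) :
    leftJumps p' n' x ≤ leftJumps p n x := by
  have := (h.neg hp hp').rightJumps_le (x := -x) (by omega) (by simpa [visits_neg] using hv)
  simpa [rightJumps_neg] using this

/-- More jumps over an edge to the right of the origin give more visits to its right end point. -/
theorem ArrowLE.visits_right_le {p p' : ℕ → ℤ} {n n' : ℕ} (hp : IsPath p) (hp' : IsPath p')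
    (h : ArrowLE p p' n n') {x : ℤ} (hx : 0 ≤ x) (hn' : p' n' ≤ x)
    (hj : rightJumps p n x ≤ rightJumps p' n' x) :
    visits p n (x + 1) ≤ visits p' n' (x + 1) := by
  by_contra! hlt
  -- At the first visit of `p` in excess, `p` has left `x + 1` leftwards at least as often as `p'`,
  -- and it has crossed the edge once more than it returned, while `p'` has returned from each
  -- crossing. So `p` has crossed too often.
  obtain ⟨m, hm, hpm, hvm⟩ := exists_visit hlt
  have h1 := (h.mono hm.le le_rfl).leftJumps_le hp hp' (x := x + 1) (by omega) hvm.ge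
  have h2 := hp.flow_of_lt hx (n := m) (by omega)
  have h3 := hp'.flow_of_le hx hn'
  have h4 := rightJumps_mono p x hm.le
  dsimp only at h4
  omega

/-- Fewer returns over an edge away from the origin give fewer visits to its left end point. -/
theorem ArrowLE.visits_left_le {p p' : ℕ → ℤ} {n n' : ℕ} (hp : IsPath p) (hp' : IsPath p')
    (h : ArrowLE p p' n n') {x : ℤ} (hx : 0 < x) (hn : x < p n) (hn' : x < p' n')
    (hj : leftJumps p' n' (x + 1) ≤ leftJumps p n (x + 1)) :
    visits p' n' x ≤ visits p n x := by
  by_contra! hlt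
  obtain ⟨m, hm, hpm, hvm⟩ := exists_visit hlt
  have h1 := (h.mono le_rfl hm.le).rightJumps_le (x := x) (by omega) hvm.ge
  have h2 := hp'.flow_of_le hx.le (n := m) (by omega)
  have h3 := hp'.flow_of_lt hx.le hn'
  have h4 := hp.flow_of_lt hx.le hn
  have h5 := leftJumps_mono p' (x + 1) hm.le
  dsimp only at h5
  omega

/-! ### Clocks at the origin -/

/-- The time spent at the origin when the next jump to the right occurs: the `i`-th jump to the
right takes an additional amount `R i / w (c + k)` of time, where `k` is the number of visits to `1`
at the end of the preceding excursion to the right. -/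
noncomputable def clock (w : ℕ → ℝ) (c : ℕ) (R : ℕ → ℝ) (p : ℕ → ℤ) : ℕ → ℝ
  | 0 => R 0 / w c
  | n + 1 => clock w c R p n + if p n = 1 ∧ p (n + 1) = 0 then
      R (leftJumps p (n + 1) 1) / w (c + visits p (n + 1) 1) else 0

section Clock

variable {w : ℕ → ℝ} {c : ℕ} {R : ℕ → ℝ} {p : ℕ → ℤ}

theorem clock_succ_of_not {n : ℕ} (h : ¬(p n = 1 ∧ p (n + 1) = 0)) :
    clock w c R p (n + 1) = clock w c R p n := by
  rw [clock, if_neg h, add_zero]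

theorem clock_succ_of {n : ℕ} (h : p n = 1 ∧ p (n + 1) = 0) :
    clock w c R p (n + 1) = clock w c R p n +
      R (leftJumps p (n + 1) 1) / w (c + visits p (n + 1) 1) := by
  rw [clock, if_pos h]

theorem clock_mono (hw : ∀ n, 0 < w n) (hR : ∀ n, 0 ≤ R n) : Monotone (clock w c R p) := by
  refine monotone_nat_of_le_succ fun n => ?_
  rw [clock]
  split_ifs
  · have := div_nonneg (hR (leftJumps p (n + 1) 1)) (hw (c + visits p (n + 1) 1)).le
    linarith
  · simp

/-- If `p` makes shorter excursions to the right of the origin and its first clock is shorter by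
`d / w c`, its clock is ahead by this amount of time. -/
theorem clock_add_le {R' : ℕ → ℝ} {p' : ℕ → ℤ} {d : ℝ} {n n' : ℕ} (hw : ∀ n, 0 < w n)
    (hmono : Monotone w) (hR : ∀ n, 0 ≤ R n) (hle : ∀ n, R' n ≤ R n)
    (hd : R' 0 + d ≤ R 0) (hp : IsPath p) (hp' : IsPath p')
    (h : ArrowLE p p' n n') (hj : leftJumps p' n' 1 ≤ leftJumps p n 1) :
    clock w c R' p' n' + d / w c ≤ clock w c R p n := by
  induction n' generalizing n with
  | zero =>
    refine le_trans ?_ (clock_mono hw hR n.zero_le)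
    rw [clock, clock, ← add_div]
    exact div_le_div_of_nonneg_right hd (hw c).le
  | succ n' ih =>
    by_cases hn' : p' n' = 1 ∧ p' (n' + 1) = 0
    · have hj' := leftJumps_succ p' n' 1
      rw [if_pos ⟨hn'.1, by omega⟩] at hj'
      -- The return of `p` from `1` to `0` of the same rank as the current return of `p'`. At that
      -- time `p` has visited `1` no more often than `p'`, so its weight is not larger and its clock
      -- gains at least as much.
      obtain ⟨m, hm, ⟨hm1, hm0⟩, hmj⟩ := exists_leftJump (p := p) (n := n)
        (k := leftJumps p' n' 1) (x := 1) (by omega)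
      have hm' : m + 1 ≤ n := hm
      have hmj1 := leftJumps_succ p m 1
      rw [if_pos ⟨hm1, hm0⟩] at hmj1
      have hm0' : p (m + 1) = 0 := by omega
      have h1 := ih (h.mono hm.le n'.le_succ) hmj.ge
      have hv : visits p (m + 1) 1 ≤ visits p' (n' + 1) 1 := by
        refine (h.mono hm' le_rfl).visits_right_le hp hp' (x := 0) le_rfl
          (by omega) ?_
        rw [hp.flow_of_le le_rfl (by omega), hp'.flow_of_le le_rfl (by omega), zero_add]
        omega
      have h2 : R' (leftJumps p' (n' + 1) 1) / w (c + visits p' (n' + 1) 1) ≤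
          R (leftJumps p (m + 1) 1) / w (c + visits p (m + 1) 1) := by
        rw [show leftJumps p (m + 1) 1 = leftJumps p' (n' + 1) 1 by omega]
        exact div_le_div₀ (hR _) (hle _) (hw _) (hmono (by omega))
      have h3 := clock_mono (c := c) (p := p) hw hR hm'
      rw [clock_succ_of ⟨hm1, hm0'⟩] at h3
      rw [clock_succ_of hn']
      linarith
    · have hj' := leftJumps_succ p' n' 1
      rw [clock_succ_of_not hn']
      refine ih (h.mono le_rfl n'.le_succ) ?_
      omega

end Clock

/-! ### Coupled paths -/

/-- The path `p` jumps from the origin according to the clocks `R` (to the right) and `L` (to the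
left), `c` and `c'` being the initial local times of `1` and `-1`. -/
structure ClockRule (w : ℕ → ℝ) (c c' : ℕ) (R L : ℕ → ℝ) (p : ℕ → ℤ) : Prop where
  right : ∀ n, p n = 0 → p (n + 1) = 1 → clock w c R p n ≤ clock w c' L (-p) n
  left : ∀ n, p n = 0 → p (n + 1) = -1 → clock w c' L (-p) n ≤ clock w c R p n

theorem ClockRule.neg {w : ℕ → ℝ} {c c' : ℕ} {R L : ℕ → ℝ} {p : ℕ → ℤ}
    (h : ClockRule w c c' R L p) : ClockRule w c' c L R (-p) := by
  constructor
  · intro n h1 h2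
    rw [neg_neg]
    simp only [Pi.neg_apply] at h1 h2
    exact h.left n (by omega) (by omega)
  · intro n h1 h2
    rw [neg_neg]
    simp only [Pi.neg_apply] at h1 h2
    exact h.right n (by omega) (by omega)

/-- Two paths `p` and `p'` driven by comparable clocks at the origin and by the same monotone rule
elsewhere, such that `p'` is pushed to the right. -/
structure Coupled (w : ℕ → ℝ) (c c' : ℕ) (R L R' L' : ℕ → ℝ) (d e : ℝ) (p p' : ℕ → ℤ) : Prop where
  pos : ∀ n, 0 < w n
  mono : Monotone w
  path : IsPath p
  path' : IsPath p'
  rule : ClockRule w c c' R L p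
  rule' : ClockRule w c c' R' L' p'
  R_nonneg : ∀ n, 0 ≤ R n
  R'_nonneg : ∀ n, 0 ≤ R' n
  L_nonneg : ∀ n, 0 ≤ L n
  L'_nonneg : ∀ n, 0 ≤ L' n
  R_le : ∀ n, R' n ≤ R n
  L_le : ∀ n, L n ≤ L' n
  d_le : R' 0 + d ≤ R 0
  e_le : L 0 + e ≤ L' 0
  d_nonneg : 0 ≤ d
  e_nonneg : 0 ≤ e
  add_pos : 0 < d + e
  arrow : ∀ n n', p n = p' n' → p n ≠ 0 → visits p n (p n) = visits p' n' (p n) →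
    visits p n (p n + 1) ≤ visits p' n' (p n + 1) →
    visits p' n' (p n - 1) ≤ visits p n (p n - 1) →
    p (n + 1) = p n + 1 → p' (n' + 1) = p' n' + 1

/-! ### Monotonicity of the coupling -/

namespace Coupled

variable {w : ℕ → ℝ} {c c' : ℕ} {R L R' L' : ℕ → ℝ} {d e : ℝ} {p p' : ℕ → ℤ}

/-- Reflection swaps the paths, the two sides and the advances `d` and `e`, so it is enough to argue
to the right of the origin. -/
theorem neg (h : Coupled w c c' R L R' L' d e p p') :
    Coupled w c' c L' R' L R e d (-p') (-p) where
  pos := h.pos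
  mono := h.mono
  path := h.path'.neg
  path' := h.path.neg
  rule := h.rule'.neg
  rule' := h.rule.neg
  R_nonneg := h.L'_nonneg
  R'_nonneg := h.L_nonneg
  L_nonneg := h.R'_nonneg
  L'_nonneg := h.R_nonneg
  R_le := h.L_le
  L_le := h.R_le
  d_le := h.e_le
  e_le := h.d_le
  d_nonneg := h.e_nonneg
  e_nonneg := h.d_nonneg
  add_pos := by linarith [h.add_pos]
  arrow := by
    intro n n' h1 h2 h3 h4 h5 h6
    simp only [Pi.neg_apply, visits_neg, neg_neg, neg_add, neg_sub] at h1 h2 h3 h4 h5 h6 ⊢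
    have h7 : p n' = p' n := by omega
    have h8 := h.arrow n' n h7 (by omega) (by rw [h7, h3])
      (by rw [h7, add_comm]; rwa [sub_neg_eq_add] at h5)
      (by rw [h7]; rwa [← sub_eq_add_neg] at h4)
    have := h.path.step n'
    have := h.path'.step n
    omega

theorem clock_right (h : Coupled w c c' R L R' L' d e p p') {n n' : ℕ} (ha : ArrowLE p p' n n')
    (hj : leftJumps p' n' 1 ≤ leftJumps p n 1) :
    clock w c R' p' n' + d / w c ≤ clock w c R p n :=
  clock_add_le h.pos h.mono h.R_nonneg h.R_le h.d_le h.path h.path' ha hj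

theorem clock_left (h : Coupled w c c' R L R' L' d e p p') {n n' : ℕ} (ha : ArrowLE p p' n n')
    (hj : rightJumps p n (-1) ≤ rightJumps p' n' (-1)) :
    clock w c' L (-p) n + e / w c' ≤ clock w c' L' (-p') n' :=
  h.neg.clock_right (ha.neg h.path h.path') (by simpa [leftJumps_neg] using hj)

/-- The origin carries no arrows, so the left neighbour of `1` is compared through the clocks.
Otherwise, at suitable times, `p` jumps right and `p'` jumps left, and the right clock of `p'` plus
`d / w c` is at most the right clock of `p`, hence its left clock, hence the left clock of `p'`
minus `e / w c'`, hence the right clock of `p'` minus `e / w c'`. This contradicts `0 < d + e`. -/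
theorem visits_zero_le (h : Coupled w c c' R L R' L' d e p p') {n n' : ℕ}
    (ha : ArrowLE p p' n n') (hn : 0 < p n) (hn' : 0 < p' n')
    (hj : leftJumps p' n' 1 ≤ leftJumps p n 1) : visits p' n' 0 ≤ visits p n 0 := by
  have f := h.path.flow_of_lt le_rfl hn
  have f' := h.path'.flow_of_lt le_rfl hn'
  rw [zero_add] at f f'
  rw [h.path.visits_eq, h.path'.visits_eq]
  suffices leftJumps p' n' 0 ≤ leftJumps p n 0 by omega
  by_contra! hlt
  -- `m` is the last right jump of `p` from the origin before `n`; `m'` is the first left jump of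
  -- `p'` in excess of those of `p`.
  obtain ⟨m, hm, ⟨hm0, hm1⟩, hmj⟩ := exists_rightJump (p := p) (n := n) (k := leftJumps p n 1)
    (x := 0) (by omega)
  obtain ⟨m', hm', ⟨hm0', hm1'⟩, hmj'⟩ := exists_leftJump hlt
  have hR := h.rule.right m hm0 (by omega)
  have hL := h.rule'.left m' hm0' (by omega)
  have f1 := h.path.flow_of_le le_rfl (n := m) hm0.le
  have f2 := h.path'.flow_of_le le_rfl (n := m') hm0'.le
  have f3 := h.path.neg.flow_of_le le_rfl (n := m) (by simp [hm0])
  have f4 := h.path'.neg.flow_of_le le_rfl (n := m') (by simp [hm0'])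
  simp only [rightJumps_neg, leftJumps_neg, zero_add, neg_zero] at f1 f2 f3 f4
  have g1 := rightJumps_mono p' 0 hm'.le
  have g2 := leftJumps_mono p 0 hm.le
  have g3 := leftJumps_mono p' 1 hm'.le
  dsimp only at g1 g2 g3
  have c1 := h.clock_right (n := m) (n' := m') (ha.mono hm.le hm'.le) (by omega)
  have c2 := h.clock_left (n := m) (n' := m') (ha.mono hm.le hm'.le) (by omega)
  have e1 := div_nonneg h.d_nonneg (h.pos c).le
  have e2 := div_nonneg h.e_nonneg (h.pos c').le
  have e3 : 0 < d / w c + e / w c' := by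
    rcases h.d_nonneg.eq_or_lt with h0 | h0
    · have : 0 < e := by linarith [h.add_pos]
      have := div_pos this (h.pos c')
      linarith
    · have := div_pos h0 (h.pos c)
      linarith
  linarith

theorem visits_le (h : Coupled w c c' R L R' L' d e p p') {n n' : ℕ}
    (ha : ArrowLE p p' n n') (hn : p n = p' n') (hpos : 0 < p n)
    (hv : visits p n (p n) = visits p' n' (p n)) :
    visits p n (p n + 1) ≤ visits p' n' (p n + 1) ∧
      visits p' n' (p n - 1) ≤ visits p n (p n - 1) := by
  refine ⟨ha.visits_right_le h.path h.path' hpos.le hn.ge (ha.rightJumps_le hpos.ne' hv.le), ?_⟩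
  have hj := ha.leftJumps_le h.path h.path' hpos.ne' hv.ge
  rcases eq_or_lt_of_le (show 1 ≤ p n by omega) with h1 | h1
  · rw [← h1] at hj ⊢
    exact h.visits_zero_le ha (by omega) (by omega) hj
  · exact ha.visits_left_le h.path h.path' (by omega) (by omega) (by omega)
      (by rwa [sub_add_cancel])

/-- The field `arrow` compares two jumps only if the visits to the neighbours are ordered, and this
order follows from the arrows used earlier. Induction along `p` closes the loop; negative sites
follow by reflection. -/
theorem arrowLE (h : Coupled w c c' R L R' L' d e p p') (n n' : ℕ) : ArrowLE p p' n n' := by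
  induction n generalizing n' with
  | zero => intro m hm; omega
  | succ n ih =>
    intro m hm m' hm' hpm h0 hv hright
    have ha : ArrowLE p p' m m' := (ih m').mono (by omega) le_rfl
    rcases lt_or_gt_of_ne h0 with hneg | hpos
    · have := h.neg.visits_le (ha.neg h.path h.path') (by simp [hpm]) (by simp; omega)
        (by simp only [Pi.neg_apply, visits_neg, neg_neg]; rw [← hpm, hv])
      simp only [Pi.neg_apply, visits_neg, ← hpm] at this
      exact h.arrow m m' hpm h0 hv (by simpa [add_comm] using this.2)
        (by simpa [add_comm, ← sub_eq_add_neg] using this.1) hright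
    · obtain ⟨h1, h2⟩ := h.visits_le ha hpm hpos hv
      exact h.arrow m m' hpm h0 hv h1 h2 hright

end Coupled

/-! ### The clocks and the potential `W` -/

/-- If the averages of the clocks are bounded, the time spent at the origin is controlled by the
potential of the local time of the neighbour. -/
theorem clock_le_mul_sum {w : ℕ → ℝ} {c : ℕ} {R : ℕ → ℝ} {p : ℕ → ℤ} {C : ℝ}
    (hw : ∀ n, 0 < w n) (hmono : Monotone w)
    (hC : ∀ m, ∑ i ∈ Finset.range m, R i ≤ C * m) (hC0 : 0 ≤ C) (n : ℕ) :
    clock w c R p n ≤ C * ∑ k ∈ Finset.range (c + visits p n 1 + 1), 1 / w k := by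
  -- Summation by parts as an invariant. The bracket is the unused part of a budget of `C` per
  -- clock, nonnegative by `hC`. A visit to `1` increases the weight, which shrinks the slack term,
  -- and adds `C / w` on the right; a return to `0` starts one more clock, paid by this `C / w`. The
  -- `+ 1` counts the clock `R 0`, present from the start.
  suffices H : clock w c R p n + (C * (leftJumps p n 1 + 1 : ℕ) -
      ∑ i ∈ Finset.range (leftJumps p n 1 + 1), R i) / w (c + visits p n 1) ≤
      C * ∑ k ∈ Finset.range (c + visits p n 1 + 1), 1 / w k by
    have := div_nonneg (sub_nonneg.2 (hC (leftJumps p n 1 + 1))) (hw (c + visits p n 1)).le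
    linarith
  induction n with
  | zero =>
    simp only [clock, leftJumps_zero, zero_add, Finset.range_one, Finset.sum_singleton,
      visits_zero, add_zero, Nat.cast_one, mul_one]
    rw [Finset.sum_range_succ, mul_add, ← add_div, add_sub_cancel, mul_one_div]
    have : 0 ≤ C * ∑ k ∈ Finset.range c, 1 / w k :=
      mul_nonneg hC0 (Finset.sum_nonneg fun k _ => (one_div_pos.2 (hw k)).le)
    linarith
  | succ n ih =>
    have hnn := sub_nonneg.2 (hC (leftJumps p n 1 + 1))
    by_cases h1 : p n = 1
    · have hv : visits p (n + 1) 1 = visits p n 1 + 1 := by rw [visits_succ, if_pos h1]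
      have hwle : w (c + visits p n 1) ≤ w (c + visits p n 1 + 1) := hmono (Nat.le_succ _)
      have hdiv := div_le_div_of_nonneg_left hnn (hw (c + visits p n 1)) hwle
      have hwp := hw (c + visits p n 1 + 1)
      rw [hv, ← add_assoc, Finset.sum_range_succ _ (c + visits p n 1 + 1), mul_add, mul_one_div]
      by_cases h0 : p (n + 1) = 0
      · have hj := leftJumps_succ p n 1
        rw [if_pos ⟨h1, by omega⟩] at hj
        rw [clock_succ_of ⟨h1, h0⟩, hv, hj, Finset.sum_range_succ _ (leftJumps p n 1 + 1),
          ← add_assoc]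
        have : (C * ((leftJumps p n 1 + 1 + 1 : ℕ) : ℝ) -
            (∑ i ∈ Finset.range (leftJumps p n 1 + 1), R i + R (leftJumps p n 1 + 1))) /
              w (c + visits p n 1 + 1) =
            (C * ((leftJumps p n 1 + 1 : ℕ) : ℝ) -
              ∑ i ∈ Finset.range (leftJumps p n 1 + 1), R i) / w (c + visits p n 1 + 1) +
            C / w (c + visits p n 1 + 1) -
              R (leftJumps p n 1 + 1) / w (c + visits p n 1 + 1) := by
          push_cast
          ring
        linarith
      · have hj := leftJumps_succ p n 1
        rw [if_neg (by omega), add_zero] at hj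
        rw [clock_succ_of_not (by tauto), hj]
        have := div_nonneg hC0 hwp.le
        linarith
    · have hv : visits p (n + 1) 1 = visits p n 1 := by rw [visits_succ, if_neg h1, add_zero]
      have hj : leftJumps p (n + 1) 1 = leftJumps p n 1 := by
        rw [leftJumps_succ, if_neg (by tauto), add_zero]
      rw [hv, hj, clock_succ_of_not (by tauto)]
      exact ih

/-! ### Paths which jump infinitely often in both directions -/

/-- `p` jumps infinitely often from the origin to the right and to the left. -/
structure Oscillates (p : ℕ → ℤ) : Prop where
  right : ∀ k, ∃ n, k < rightJumps p n 0
  left : ∀ k, ∃ n, k < leftJumps p n 0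

namespace Oscillates

variable {p : ℕ → ℤ}

theorem neg (h : Oscillates p) : Oscillates (-p) :=
  ⟨by simpa [rightJumps_neg] using h.left, by simpa [leftJumps_neg] using h.right⟩

theorem exists_right (h : Oscillates p) (n : ℕ) : ∃ m ≥ n, p m = 0 ∧ p (m + 1) = 1 := by
  obtain ⟨k, hk⟩ := h.right (rightJumps p n 0)
  obtain ⟨m, -, ⟨hm0, hm1⟩, hmj⟩ := exists_rightJump hk
  refine ⟨m, ?_, hm0, by omega⟩
  by_contra! hlt
  have h1 := rightJumps_mono p 0 (show m + 1 ≤ n from hlt)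
  have h2 := rightJumps_succ p m 0
  rw [if_pos ⟨hm0, hm1⟩] at h2
  dsimp only at h1
  omega

theorem exists_left (h : Oscillates p) (n : ℕ) : ∃ m ≥ n, p m = 0 ∧ p (m + 1) = -1 := by
  obtain ⟨m, hm, h0, h1⟩ := h.neg.exists_right n
  simp only [Pi.neg_apply] at h0 h1
  exact ⟨m, hm, by omega, by omega⟩

theorem exists_leftJumps_one (h : Oscillates p) (hp : IsPath p) (k : ℕ) :
    ∃ n, k ≤ leftJumps p n 1 := by
  obtain ⟨n, hn⟩ := h.right k
  refine ⟨n, ?_⟩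
  have := hp.flow le_rfl n
  rw [zero_add] at this
  split_ifs at this <;> omega

end Oscillates

/-- A path which visits the origin infinitely often but jumps finitely many times to the right
eventually stays to the left of the origin. -/
theorem IsPath.visits_of_rightJumps_le {p : ℕ → ℤ} (hp : IsPath p)
    (hv : Tendsto (fun n => visits p n 0) atTop atTop) {K : ℕ} (hK : ∀ n, rightJumps p n 0 ≤ K) :
    (∃ K', ∀ n, visits p n 1 ≤ K') ∧ Tendsto (fun n => visits p n (-1)) atTop atTop := by
  obtain ⟨M, hM⟩ : ∃ M, ∀ n ≥ M, rightJumps p n 0 = rightJumps p M 0 := by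
    have hbdd : BddAbove (Set.range fun n => rightJumps p n 0) := ⟨K, by rintro _ ⟨n, rfl⟩; exact hK n⟩
    obtain ⟨M, hM⟩ := Nat.sSup_mem (Set.range_nonempty _) hbdd
    refine ⟨M, fun n hn => le_antisymm ?_ (rightJumps_mono p 0 hn)⟩
    dsimp only at hM
    rw [hM]
    exact le_csSup hbdd ⟨n, rfl⟩
  obtain ⟨n₀, hn₀M, hn₀⟩ : ∃ n ≥ M, p n = 0 := by
    obtain ⟨n, hn⟩ := (hv.eventually_gt_atTop (visits p M 0)).exists
    obtain ⟨m, -, hm0, hmv⟩ := exists_visit hn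
    refine ⟨m, ?_, hm0⟩
    by_contra! hlt
    have h1 := visits_mono p 0 (show m + 1 ≤ M from hlt)
    have h2 := visits_succ p m 0
    rw [if_pos hm0] at h2
    dsimp only at h1
    omega
  have hstay : ∀ n ≥ n₀, p n ≤ 0 ∧ visits p n 1 = visits p n₀ 1 := by
    intro n hn
    induction n, hn using Nat.le_induction with
    | base => exact ⟨hn₀.le, rfl⟩
    | succ n hn ih =>
      have h1 := rightJumps_succ p n 0
      rw [hM n (by omega), hM (n + 1) (by omega)] at h1
      have h2 : ¬(p n = 0 ∧ p (n + 1) = 0 + 1) := by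
        intro h
        rw [if_pos h] at h1
        omega
      have := hp.step n
      refine ⟨by omega, ?_⟩
      rw [visits_succ, if_neg (by omega), ih.2, add_zero]
  refine ⟨⟨visits p n₀ 1, fun n => ?_⟩, ?_⟩
  · rcases le_total n₀ n with h | h
    · exact (hstay n h).2.le
    · exact visits_mono p 1 h
  -- At most `K` visits to `0` end with a right jump, and at most one left jump has not yet been
  -- followed by a return from `-1`.
  · have hle : ∀ n, visits p n 0 - (K + 1) ≤ visits p n (-1) := by
      intro n
      have h1 := hp.visits_eq n 0
      have h2 := hp.neg.flow le_rfl n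
      have h3 := hp.visits_eq n (-1)
      have h4 := hK n
      simp only [rightJumps_neg, leftJumps_neg, neg_zero, zero_add] at h2
      split_ifs at h2 <;> omega
    exact tendsto_atTop_mono hle ((tendsto_sub_atTop_nat (K + 1)).comp hv)

theorem not_tendsto_of_bdd_of_tendsto {f g : ℕ → ℝ} {B δ : ℝ} (hf : ∀ n, f n ≤ B)
    (hg : Tendsto g atTop atTop) : ¬Tendsto (fun n => f n - g n) atTop (𝓝 δ) := by
  intro h
  have : Tendsto (fun n => f n - g n) atTop atBot := by
    refine tendsto_atBot_mono (fun n => sub_le_sub_right (hf n) (g n)) ?_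
    exact tendsto_atBot_add_const_left _ _ (tendsto_neg_atTop_atBot.comp hg)
  exact not_tendsto_nhds_of_tendsto_atBot this δ h

/-- If the difference of the potentials at both neighbours of the origin converges, the path
jumps infinitely often in both directions. -/
theorem IsPath.oscillates {p : ℕ → ℤ} (hp : IsPath p) {F G : ℕ → ℝ} (hF : Monotone F)
    (hG : Monotone G) (hF' : Tendsto F atTop atTop) (hG' : Tendsto G atTop atTop)
    (hv : Tendsto (fun n => visits p n 0) atTop atTop) {δ : ℝ}
    (hY : Tendsto (fun n => F (visits p n 1) - G (visits p n (-1))) atTop (𝓝 δ)) :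
    Oscillates p := by
  constructor
  · by_contra! h
    obtain ⟨K, hK⟩ := h
    obtain ⟨⟨K', hK'⟩, ht⟩ := hp.visits_of_rightJumps_le hv hK
    exact not_tendsto_of_bdd_of_tendsto (fun n => hF (hK' n)) (hG'.comp ht) hY
  · by_contra! h
    obtain ⟨K, hK⟩ := h
    obtain ⟨⟨K', hK'⟩, ht⟩ := hp.neg.visits_of_rightJumps_le (by simpa [visits_neg] using hv)
      (K := K) (by simpa [rightJumps_neg] using hK)
    simp only [visits_neg, neg_neg] at hK' ht
    refine not_tendsto_of_bdd_of_tendsto (fun n => hG (hK' n)) (hF'.comp ht) (δ := -δ) ?_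
    simpa using hY.neg

/-- `n` is a time spent at the origin at which both clocks `A` and `B` are above level `s`. -/
def AboveLevel (A B : ℕ → ℝ) (p : ℕ → ℤ) (s : ℝ) (n : ℕ) : Prop := p n = 0 ∧ s < A n ∧ s < B n

/-! ### Two coupled paths cannot share the limit -/

namespace Coupled

variable {w : ℕ → ℝ} {c c' : ℕ} {R L R' L' : ℕ → ℝ} {d e : ℝ} {p p' : ℕ → ℤ}

/-- Going round the cycle right clock of `p'`, right clock of `p`, left clock of `p`, left clock of
`p'`, right clock of `p'`, the value never drops and gains `d / w c` at the first passage.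
Infinitely many jumps in both directions allow the cycle to be repeated forever. -/
theorem clock_unbounded (h : Coupled w c c' R L R' L' d e p p') (hd : 0 < d) (ho : Oscillates p)
    (ho' : Oscillates p') (s : ℝ) :
    (∃ n, s < clock w c R p n) ∧ (∃ n, s < clock w c' L (-p) n) ∧
      (∃ n, s < clock w c R' p' n) ∧ ∃ n, s < clock w c' L' (-p') n := by
  have hD : 0 < d / w c := div_pos hd (h.pos c)
  have h1 : ∀ n, ∃ m, clock w c R p n ≤ clock w c' L (-p) m := fun n => by
    obtain ⟨m, hm, h0, h1⟩ := ho.exists_right n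
    exact ⟨m, (clock_mono h.pos h.R_nonneg hm).trans (h.rule.right m h0 h1)⟩
  have h2 : ∀ n, ∃ m, clock w c' L' (-p') n ≤ clock w c R' p' m := fun n => by
    obtain ⟨m, hm, h0, h1⟩ := ho'.exists_left n
    exact ⟨m, (clock_mono h.pos h.L'_nonneg hm).trans (h.rule'.left m h0 h1)⟩
  have h3 : ∀ n, ∃ m, clock w c R' p' n + d / w c ≤ clock w c R p m := fun n => by
    obtain ⟨m, hm⟩ := ho.exists_leftJumps_one h.path (leftJumps p' n 1)
    exact ⟨m, h.clock_right (h.arrowLE m n) hm⟩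
  have h4 : ∀ n, ∃ m, clock w c' L (-p) n ≤ clock w c' L' (-p') m := fun n => by
    obtain ⟨m, hm⟩ := ho'.neg.exists_leftJumps_one h.path'.neg (rightJumps p n (-1))
    refine ⟨m, ?_⟩
    have := h.clock_left (n := n) (h.arrowLE n m) (by simpa [leftJumps_neg] using hm)
    linarith [div_nonneg h.e_nonneg (h.pos c').le]
  have h5 : ∀ k : ℕ, ∃ n, clock w c R' p' 0 + k * (d / w c) ≤ clock w c R' p' n := by
    intro k
    induction k with
    | zero => exact ⟨0, by simp⟩
    | succ k ih =>
      obtain ⟨n, hn⟩ := ih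
      obtain ⟨m₁, hm₁⟩ := h3 n
      obtain ⟨m₂, hm₂⟩ := h1 m₁
      obtain ⟨m₃, hm₃⟩ := h4 m₂
      obtain ⟨m₄, hm₄⟩ := h2 m₃
      refine ⟨m₄, ?_⟩
      push_cast
      linarith
  obtain ⟨k, hk⟩ := exists_nat_gt ((s - clock w c R' p' 0) / (d / w c))
  rw [div_lt_iff₀ hD] at hk
  obtain ⟨n, hn⟩ := h5 k
  obtain ⟨m₁, hm₁⟩ := h3 n
  obtain ⟨m₂, hm₂⟩ := h1 m₁
  obtain ⟨m₃, hm₃⟩ := h4 m₂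
  exact ⟨⟨m₁, by linarith⟩, ⟨m₂, by linarith⟩, ⟨n, by linarith⟩, ⟨m₃, by linarith⟩⟩

/-- At time `s` spent at the origin, the path `p'` has seen at least as many visits to `1` as `p` at
a time which is later by a fixed amount. -/
theorem visits_one_le (h : Coupled w c c' R L R' L' d e p p') {s : ℝ} {n n' : ℕ}
    (hn : ∀ m < n, ¬AboveLevel (clock w c R p) (clock w c' L (-p)) p (s + d / w c) m)
    (hn' : AboveLevel (clock w c R' p') (clock w c' L' (-p')) p' s n') :
    visits p n 1 ≤ visits p' n' 1 := by
  refine (h.arrowLE n n').visits_right_le h.path h.path' (x := 0) le_rfl hn'.1.le ?_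
  by_contra! hlt
  -- At the first right jump of `p` in excess, its right clock exceeds `s + d / w c` by the
  -- comparison of clocks. As `p` jumps right, its left clock is no smaller, so `m` is above the
  -- level although `m < n`.
  obtain ⟨m, hm, ⟨hm0, hm1⟩, hmj⟩ := exists_rightJump hlt
  have f := h.path.flow_of_le le_rfl hm0.le
  have f' := h.path'.flow_of_le le_rfl hn'.1.le
  rw [zero_add] at f f'
  have hc := h.clock_right (h.arrowLE m n') (by omega)
  have hr := h.rule.right m hm0 (by omega)
  exact hn m hm ⟨hm0, by linarith [hn'.2.1], by linarith [hn'.2.1]⟩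

theorem visits_neg_one_le (h : Coupled w c c' R L R' L' d e p p') {s : ℝ} {n n' : ℕ}
    (hn : AboveLevel (clock w c R p) (clock w c' L (-p)) p s n)
    (hn' : ∀ m < n', ¬AboveLevel (clock w c R' p') (clock w c' L' (-p')) p' s m) : visits p' n' (-1) ≤ visits p n (-1) := by
  -- The reflected statement raises the level by `e / w c'`, so it is applied at a level lowered by
  -- this amount.
  have := h.neg.visits_one_le (s := s - e / w c') (n := n') (n' := n) ?_ ?_
  · simpa [visits_neg] using this
  · intro m hm hl
    rw [neg_neg, sub_add_cancel] at hl
    exact hn' m hm ⟨by simpa using hl.1, hl.2.2, hl.2.1⟩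
  · have := div_nonneg h.e_nonneg (h.pos c').le
    exact ⟨by simpa using hn.1, by linarith [hn.2.2], by rw [neg_neg]; linarith [hn.2.1]⟩

theorem exists_aboveLevel {A B : ℕ → ℝ} (ho : Oscillates p) (hA : Monotone A) (hB : Monotone B)
    (hA' : ∀ s, ∃ n, s < A n) (hB' : ∀ s, ∃ n, s < B n) (s : ℝ) :
    ∃ n, AboveLevel A B p s n ∧ ∀ m < n, ¬AboveLevel A B p s m := by
  classical
  have hex : ∃ n, AboveLevel A B p s n := by
    obtain ⟨n₁, h₁⟩ := hA' s
    obtain ⟨n₂, h₂⟩ := hB' s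
    obtain ⟨m, hm, h0, -⟩ := ho.exists_right (max n₁ n₂)
    exact ⟨m, h0, h₁.trans_le (hA (le_trans (le_max_left _ _) hm)),
      h₂.trans_le (hB (le_trans (le_max_right _ _) hm))⟩
  exact ⟨Nat.find hex, Nat.find_spec hex, fun m hm => Nat.find_min hex hm⟩

/-- Two coupled paths whose first clocks differ cannot both have the same limit for the difference
of the potentials. -/
theorem not_both_tendsto (h : Coupled w c c' R L R' L' d e p p') (hd : 0 < d)
    (hdiv : Tendsto (fun n => ∑ k ∈ Finset.range n, 1 / w k) atTop atTop) {C δ : ℝ}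
    (hC : ∀ m, ∑ i ∈ Finset.range m, L i ≤ C * m)
    (hv : Tendsto (fun n => visits p n 0) atTop atTop)
    (hv' : Tendsto (fun n => visits p' n 0) atTop atTop)
    (hY : Tendsto (fun n => ∑ k ∈ Finset.range (c + visits p n 1), 1 / w k -
      ∑ k ∈ Finset.range (c' + visits p n (-1)), 1 / w k) atTop (𝓝 δ))
    (hY' : Tendsto (fun n => ∑ k ∈ Finset.range (c + visits p' n 1), 1 / w k -
      ∑ k ∈ Finset.range (c' + visits p' n (-1)), 1 / w k) atTop (𝓝 δ)) : False := by
  set S : ℕ → ℝ := fun n => ∑ k ∈ Finset.range n, 1 / w k with hS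
  have hSmono : Monotone S := monotone_nat_of_le_succ fun n => by
    simp only [hS, Finset.sum_range_succ]
    linarith [one_div_pos.2 (h.pos n)]
  have hmono : ∀ c, Monotone fun k => S (c + k) := fun c a b hab => hSmono (by omega)
  have htend : ∀ c, Tendsto (fun k => S (c + k)) atTop atTop := fun c =>
    hdiv.comp (tendsto_atTop_mono (fun k => Nat.le_add_left k c) tendsto_id)
  have ho := h.path.oscillates (hmono c) (hmono c') (htend c) (htend c') hv hY
  have ho' := h.path'.oscillates (hmono c) (hmono c') (htend c) (htend c') hv' hY'
  set D := d / w c with hDdef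
  have hD : 0 < D := div_pos hd (h.pos c)
  have hub := h.clock_unbounded hd ho ho'
  have hA := clock_mono (c := c) (p := p) h.pos h.R_nonneg
  have hB := clock_mono (c := c') (p := -p) h.pos h.L_nonneg
  have hA' := clock_mono (c := c) (p := p') h.pos h.R'_nonneg
  have hB' := clock_mono (c := c') (p := -p') h.pos h.L'_nonneg
  -- `N s` is the first time at the origin with both clocks beyond `s`; it stands for time `s` spent
  -- at the origin.
  choose N hN hNmin using exists_aboveLevel ho hA hB (fun s => (hub s).1) (fun s => (hub s).2.1)
  choose N' hN' hNmin' using exists_aboveLevel ho' hA' hB' (fun s => (hub s).2.2.1)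
    (fun s => (hub s).2.2.2)
  have hs : Tendsto (fun j : ℕ => (j : ℝ) * D) atTop atTop :=
    tendsto_natCast_atTop_atTop.atTop_mul_const hD
  have hNt : Tendsto (fun j : ℕ => N (j * D)) atTop atTop := by
    refine tendsto_atTop.2 fun M => ?_
    filter_upwards [hs.eventually_gt_atTop (clock w c R p M)] with j hj
    by_contra! hlt
    linarith [hA hlt.le, (hN (j * D)).2.1]
  have hNt' : Tendsto (fun j : ℕ => N' (j * D)) atTop atTop := by
    refine tendsto_atTop.2 fun M => ?_
    filter_upwards [hs.eventually_gt_atTop (clock w c R' p' M)] with j hj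
    by_contra! hlt
    linarith [hA' hlt.le, (hN' (j * D)).2.1]
  set f : ℕ → ℝ := fun j => S (c' + visits p (N (j * D)) (-1)) with hf
  -- The path `p'` at time `j * D` is set against `p` one step `D` later, as the advance of the
  -- right clock permits.
  have hstep : Tendsto (fun j : ℕ =>
      (S (c + visits p' (N' (j * D)) 1) - S (c' + visits p' (N' (j * D)) (-1))) -
      (S (c + visits p (N ((j + 1 : ℕ) * D)) 1) - S (c' + visits p (N ((j + 1 : ℕ) * D)) (-1))))
      atTop (𝓝 0) := by
    have := (hY'.comp hNt').sub ((hY.comp hNt).comp (tendsto_add_atTop_nat 1))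
    rwa [sub_self] at this
  have hC0 : 0 ≤ C := by
    have h1 := hC 1
    have h2 := h.L_nonneg 0
    simp at h1
    linarith
  -- Linear lower bound: the left clock is beyond `j * D` and is bounded through `clock_le_mul_sum`,
  -- whose last term is at most `1 / w 0`.
  have hlow : ∀ j : ℕ, j * D < C * (f j + 1 / w 0) := by
    intro j
    refine (hN (j * D)).2.2.trans_le ((clock_le_mul_sum h.pos h.mono hC hC0 _).trans ?_)
    rw [visits_neg, Finset.sum_range_succ]
    have := one_div_le_one_div_of_le (h.pos 0) (h.mono (Nat.zero_le (c' + visits p (N (j * D)) (-1))))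
    exact mul_le_mul_of_nonneg_left (by simp only [hf, hS]; linarith) hC0
  -- With this slope, `C * f` grows by at most `D / 2` per step, against the `D` required by `hlow`.
  -- Using `C + 1` covers `C = 0`.
  obtain ⟨J, hJ⟩ := eventually_atTop.1
    (hstep.eventually_lt_const (show (0 : ℝ) < D / (2 * (C + 1)) by positivity))
  have hinc : ∀ i : ℕ, f (J + i) ≤ f J + i * (D / (2 * (C + 1))) := by
    intro i
    induction i with
    | zero => simp
    | succ i ih =>
      have h1 := hJ (J + i) (by omega)
      -- By the two comparisons of visits, the small difference in `h1` dominates the increment of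
      -- `f`.
      have h2 := h.visits_one_le (s := ((J + i : ℕ) : ℝ) * D) (n := N ((J + i + 1 : ℕ) * D))
        (n' := N' ((J + i : ℕ) * D)) (by
          have := hNmin ((J + i + 1 : ℕ) * D)
          rwa [show ((J + i + 1 : ℕ) : ℝ) * D = ((J + i : ℕ) : ℝ) * D + D by push_cast; ring] at this ⊢)
        (hN' _)
      have h3 := h.visits_neg_one_le (hN ((J + i : ℕ) * D)) (hNmin' _)
      have h4 := hmono c h2
      have h5 := hmono c' h3
      dsimp only at h4 h5
      simp only [hf] at ih ⊢
      rw [← add_assoc]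
      push_cast at h1 h2 h3 h4 h5 ih ⊢
      linarith
  have hw0 := one_div_pos.2 (h.pos 0)
  have hfJ : 0 ≤ f J := Finset.sum_nonneg fun k _ => (one_div_pos.2 (h.pos k)).le
  obtain ⟨i, hi⟩ := exists_nat_gt (2 * C * (f J + 1 / w 0) / D)
  rw [div_lt_iff₀ hD] at hi
  have h1 := hlow (J + i)
  have h2 := mul_le_mul_of_nonneg_left (hinc i) hC0
  have h3 : C * (i * (D / (2 * (C + 1)))) ≤ i * D / 2 := by
    have : C * (i * (D / (2 * (C + 1)))) = (i * D / 2) * (C / (C + 1)) := by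
      field_simp
    rw [this]
    exact mul_le_of_le_one_right (by positivity) ((div_le_one (by positivity)).2 (by linarith))
  have h4 : 0 ≤ (J : ℝ) * D := by positivity
  push_cast at h1
  nlinarith

end Coupled

/-! ### Products of exponential distributions -/

instance : IsProbabilityMeasure (expMeasure 1) := isProbabilityMeasure_expMeasure one_pos

theorem lintegral_expMeasure (f : ℝ → ENNReal) (hf : Measurable f) :
    ∫⁻ x, f x ∂expMeasure 1 = ∫⁻ x, exponentialPDF 1 x * f x := by
  rw [expMeasure, gammaMeasure, lintegral_withDensity_eq_lintegral_mul]
  · rfl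
  · exact (measurable_gammaPDFReal 1 1).ennreal_ofReal
  · exact hf

theorem measurable_exponentialPDF (r : ℝ) : Measurable (exponentialPDF r) :=
  (measurable_exponentialPDFReal r).ennreal_ofReal

instance : NullSingletonClass (expMeasure 1) := by
  refine ⟨fun x => ?_⟩
  rw [expMeasure, gammaMeasure]
  exact withDensity_absolutelyContinuous _ _ (measure_singleton x)

theorem ae_pos_expMeasure : ∀ᵐ x ∂expMeasure 1, 0 < x := by
  have h : ∀ᵐ x ∂expMeasure 1, x ∉ Set.Iio (0 : ℝ) := by
    rw [← measure_eq_zero_iff_ae_notMem, expMeasure, gammaMeasure,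
      withDensity_apply _ measurableSet_Iio]
    exact lintegral_exponentialPDF_of_nonpos le_rfl
  have h' : ∀ᵐ x ∂expMeasure 1, x ≠ 0 := by
    rw [ae_iff]
    simp
  filter_upwards [h, h'] with x h1 h2
  simp only [Set.mem_Iio, not_lt] at h1
  exact lt_of_le_of_ne h1 (Ne.symm h2)

/-- The tilted density is `1 / (1 + c)` times the exponential density of rate `1 + c`. Nonnegative
`c` gives the probability of winning a race, `c = -1/2` an exponential moment. -/
theorem lintegral_exp_neg_mul {c : ℝ} (h1 : 0 < 1 + c) :
    ∫⁻ u, ENNReal.ofReal (Real.exp (-(u * c))) ∂expMeasure 1 = ENNReal.ofReal (1 / (1 + c)) := by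
  rw [lintegral_expMeasure _ (by fun_prop)]
  have : ∀ u, exponentialPDF 1 u * ENNReal.ofReal (Real.exp (-(u * c))) =
      ENNReal.ofReal (1 / (1 + c)) * exponentialPDF (1 + c) u := by
    intro u
    rw [exponentialPDF_eq, exponentialPDF_eq]
    split_ifs with hu
    · rw [← ENNReal.ofReal_mul (by positivity), ← ENNReal.ofReal_mul (by positivity)]
      congr 1
      rw [one_mul, one_mul, ← Real.exp_add, ← mul_assoc, one_div, inv_mul_cancel₀ h1.ne', one_mul]
      congr 1
      ring
    · simp
  simp_rw [this]
  rw [lintegral_const_mul _ (measurable_exponentialPDF _), lintegral_exponentialPDF_eq_one h1,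
    mul_one]

/-- Lack of memory of the exponential distribution. -/
theorem lintegral_exp_shift {a : ℝ} (ha : 0 ≤ a) {h : ℝ → ENNReal} (hh : Measurable h) :
    ∫⁻ v, (Set.Ioi a).indicator (fun v => h (v - a)) v ∂expMeasure 1 =
      ENNReal.ofReal (Real.exp (-a)) * ∫⁻ v, h v ∂expMeasure 1 := by
  rw [lintegral_expMeasure (fun v => (Set.Ioi a).indicator (fun v => h (v - a)) v)
      ((hh.comp (measurable_id.sub_const a)).indicator measurableSet_Ioi),
    lintegral_expMeasure _ hh, ← lintegral_const_mul' _ _ ENNReal.ofReal_ne_top,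
    ← lintegral_add_right_eq_self _ a]
  -- After the shift the indicator requires `0 < v`, whereas the density does not vanish at `0`.
  have h0 : ∀ᵐ v : ℝ, v ≠ 0 := by
    rw [ae_iff]
    simp
  refine lintegral_congr_ae ?_
  filter_upwards [h0] with v hv
  rcases lt_or_gt_of_ne hv with h1 | h1
  · rw [Set.indicator_of_notMem (by simp [h1.le]), exponentialPDF_of_neg h1]
    simp
  · rw [Set.indicator_of_mem (by simpa using h1), exponentialPDF_of_nonneg (by linarith),
      exponentialPDF_of_nonneg h1.le, add_sub_cancel_right, ← mul_assoc,
      ← ENNReal.ofReal_mul (by positivity)]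
    congr 2
    rw [one_mul, one_mul, one_mul, one_mul, ← Real.exp_add]
    congr 1
    ring

/-- In a race between two exponential clocks, the residual time of the loser is exponential and
independent of the outcome. -/
theorem lintegral_race {α β : ℝ} (hα : 0 < α) (hβ : 0 ≤ β) {h : ℝ → ENNReal} (hh : Measurable h) :
    ∫⁻ u, ∫⁻ v, {v | u * β < v * α}.indicator (fun v => h (v - u * β / α)) v ∂expMeasure 1
      ∂expMeasure 1 = ENNReal.ofReal (α / (α + β)) * ∫⁻ v, h v ∂expMeasure 1 := by
  have hc : 0 ≤ β / α := div_nonneg hβ hα.le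
  have : (fun u => ∫⁻ v, {v | u * β < v * α}.indicator (fun v => h (v - u * β / α)) v ∂expMeasure 1)
      =ᵐ[expMeasure 1] fun u => ENNReal.ofReal (Real.exp (-(u * (β / α)))) *
        ∫⁻ v, h v ∂expMeasure 1 := by
    filter_upwards [ae_pos_expMeasure] with u hu
    rw [← lintegral_exp_shift (mul_nonneg hu.le hc) hh]
    have : {v | u * β < v * α} = Set.Ioi (u * (β / α)) := by
      ext v
      rw [Set.mem_ofPred_eq, Set.mem_Ioi, ← mul_div_assoc, div_lt_iff₀ hα]
    rw [this, mul_div_assoc]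
  rw [lintegral_congr_ae this, lintegral_mul_const _ (by fun_prop), lintegral_exp_neg_mul (by linarith)]
  congr 2
  field_simp

/-! ### Infinite families of clocks: relabelling, resampling and races -/

section Product

variable {ι : Type*}

/-- The law of a family of independent exponential clocks. -/
noncomputable def clockLaw (ι : Type*) : Measure (ι → ℝ) :=
  Measure.infinitePi fun _ : ι => expMeasure 1

instance : IsProbabilityMeasure (clockLaw ι) := by unfold clockLaw; infer_instance

/-- The coordinates are independent with a common law, so any selection without repetition has the
same joint law. This covers the removal of clocks from the tops of stacks. -/
theorem clockLaw_map_comp {g : ι → ι} (hg : Function.Injective g) :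
    (clockLaw ι).map (fun e => e ∘ g) = clockLaw ι := by
  refine Measure.eq_infinitePi _ fun s t ht => ?_
  have hm : Measurable fun e : ι → ℝ => e ∘ g := measurable_pi_lambda _ fun i => measurable_pi_apply _
  rw [Measure.map_apply hm (MeasurableSet.pi s.countable_toSet fun i _ => ht i)]
  have : (fun e : ι → ℝ => e ∘ g) ⁻¹' (Set.pi s t) =
      Set.pi (s.map ⟨g, hg⟩) (Function.extend g t fun _ => Set.univ) := by
    ext e
    simp [Set.mem_pi, hg.extend_apply]
  rw [this, clockLaw, Measure.infinitePi_pi, Finset.prod_map]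
  · simp [hg.extend_apply]
  · intro i hi
    obtain ⟨j, -, rfl⟩ := Finset.mem_map.1 hi
    simpa [hg.extend_apply] using ht j

theorem lintegral_clockLaw_comp {g : ι → ι} (hg : Function.Injective g) {f : (ι → ℝ) → ENNReal}
    (hf : Measurable f) : ∫⁻ e, f (e ∘ g) ∂clockLaw ι = ∫⁻ e, f e ∂clockLaw ι := by
  conv_rhs => rw [← clockLaw_map_comp hg]
  rw [lintegral_map hf]
  exact measurable_pi_lambda _ fun i => measurable_pi_apply _

variable [DecidableEq ι]

theorem measurable_update_prod (i : ι) :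
    Measurable fun q : ℝ × (ι → ℝ) => Function.update q.2 i q.1 := by
  refine measurable_pi_lambda _ fun j => ?_
  by_cases hj : j = i
  · subst hj
    simpa using measurable_fst
  · simp only [Function.update_of_ne hj]
    exact (measurable_pi_apply j).comp measurable_snd

/-- One coordinate may be replaced by an independent copy. -/
theorem clockLaw_map_update (i : ι) :
    ((expMeasure 1).prod (clockLaw ι)).map (fun q => Function.update q.2 i q.1) = clockLaw ι := by
  refine Measure.eq_infinitePi _ fun s t ht => ?_
  rw [Measure.map_apply (measurable_update_prod i)
    (MeasurableSet.pi s.countable_toSet fun i _ => ht i)]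
  have : (fun q : ℝ × (ι → ℝ) => Function.update q.2 i q.1) ⁻¹' (Set.pi s t) =
      (if i ∈ s then t i else Set.univ) ×ˢ Set.pi (s.erase i) t := by
    ext ⟨u, e⟩
    simp only [Set.mem_preimage, Set.mem_pi, Set.mem_prod, Finset.mem_coe, Finset.mem_erase]
    constructor
    · intro h
      refine ⟨?_, fun j hj => by simpa [Function.update_of_ne hj.1] using h j hj.2⟩
      split_ifs with hi
      · simpa using h i hi
      · trivial
    · rintro ⟨h1, h2⟩ j hj
      by_cases hji : j = i
      · subst hji
        simpa [hj] using h1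
      · simpa [Function.update_of_ne hji] using h2 j ⟨hji, hj⟩
  rw [this, Measure.prod_prod, clockLaw, Measure.infinitePi_pi _ fun j _ => ht j]
  split_ifs with hi
  · rw [Finset.mul_prod_erase s (fun j => expMeasure 1 (t j)) hi]
  · rw [measure_univ, one_mul, Finset.erase_eq_of_notMem hi]

theorem lintegral_clockLaw_update (i : ι) {f : (ι → ℝ) → ENNReal} (hf : Measurable f) :
    ∫⁻ e, f e ∂clockLaw ι =
      ∫⁻ e, ∫⁻ u, f (Function.update e i u) ∂expMeasure 1 ∂clockLaw ι := by
  conv_lhs => rw [← clockLaw_map_update i]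
  rw [lintegral_map hf (measurable_update_prod i)]
  exact lintegral_prod_symm' _ (hf.comp (measurable_update_prod i))

/-- Fubini in one coordinate, the other clocks being frozen. -/
theorem ae_clockLaw_of_update (i : ι) {p : (ι → ℝ) → Prop} (hp : MeasurableSet {e | p e})
    (h : ∀ e, ∀ᵐ u ∂expMeasure 1, p (Function.update e i u)) : ∀ᵐ e ∂clockLaw ι, p e := by
  have := lintegral_clockLaw_update i (f := {e | p e}ᶜ.indicator 1)
    (measurable_one.indicator hp.compl)
  rw [lintegral_indicator_one hp.compl] at this
  rw [ae_iff]
  change clockLaw ι {e | p e}ᶜ = 0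
  rw [this]
  refine (lintegral_congr fun e => ?_).trans lintegral_zero
  refine (lintegral_congr_ae ?_).trans lintegral_zero
  filter_upwards [h e] with u hu
  simp [hu]

theorem ae_clockLaw_pos (i : ι) : ∀ᵐ e ∂clockLaw ι, 0 < e i :=
  ae_clockLaw_of_update i (measurableSet_lt measurable_const (measurable_pi_apply i)) fun e => by
    simpa using ae_pos_expMeasure

theorem ae_clockLaw_ne {i j : ι} (hij : i ≠ j) {α β : ℝ} (h : α ≠ 0 ∨ β ≠ 0) :
    ∀ᵐ e ∂clockLaw ι, e i * β ≠ e j * α := by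
  have hm : MeasurableSet {e : ι → ℝ | e i * β ≠ e j * α} :=
    (measurableSet_eq_fun (by fun_prop) (by fun_prop)).compl
  have key : ∀ a b : ℝ, b ≠ 0 → ∀ᵐ u ∂expMeasure 1, a ≠ u * b := fun a b hb => by
    have : ∀ᵐ u ∂expMeasure 1, u ≠ a / b := by
      rw [ae_iff]
      simp
    filter_upwards [this] with u hu h
    exact hu (by rw [h, mul_div_cancel_right₀ _ hb])
  rcases h with h | h
  · refine ae_clockLaw_of_update j hm fun e => ?_
    simpa [Function.update_of_ne hij] using key (e i * β) α h
  · refine ae_clockLaw_of_update i hm fun e => ?_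
    filter_upwards [key (e j * α) β h] with u hu
    simpa [Function.update_of_ne hij.symm] using hu.symm

/-- The winner of a race is replaced by a fresh clock, the loser by its residual time. -/
theorem lintegral_race_residual {i j : ι} (hij : i ≠ j) {g : ι → ι} (hg : Function.Injective g)
    (hi : ∀ k, g k ≠ i) (hj : g j = j) {α β : ℝ} (hα : 0 < α) (hβ : 0 ≤ β)
    {f : (ι → ℝ) → ENNReal} (hf : Measurable f) :
    ∫⁻ e, {e : ι → ℝ | e i * β < e j * α}.indicator
      (fun e => f (Function.update (e ∘ g) j (e j - e i * β / α))) e ∂clockLaw ι =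
      ENNReal.ofReal (α / (α + β)) * ∫⁻ e, f e ∂clockLaw ι := by
  have hcomp : Measurable fun e : ι → ℝ => e ∘ g :=
    measurable_pi_lambda _ fun i => measurable_pi_apply _
  have hms : MeasurableSet {e : ι → ℝ | e i * β < e j * α} :=
    measurableSet_lt (by fun_prop) (by fun_prop)
  have hF : Measurable ({e : ι → ℝ | e i * β < e j * α}.indicator
      (fun e => f (Function.update (e ∘ g) j (e j - e i * β / α)))) := by
    refine Measurable.indicator (hf.comp ?_) hms
    exact (measurable_update_prod j).comp
      (Measurable.prodMk (by fun_prop : Measurable fun e : ι → ℝ => e j - e i * β / α) hcomp)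
  -- `e ∘ g` never reads the coordinate `i`, and it reads `j` only at position `j`, which is
  -- overwritten. The resampled clocks therefore enter only through the residual.
  have hu : ∀ (e : ι → ℝ) (u v r : ℝ), Function.update
      (Function.update (Function.update e i u) j v ∘ g) j r = Function.update (e ∘ g) j r := by
    intro e u v r
    ext k
    by_cases hk : k = j
    · subst hk
      simp
    · have : g k ≠ j := fun h => hk (hg (h.trans hj.symm))
      simp [Function.update_of_ne hk, Function.update_of_ne this, Function.update_of_ne (hi k)]
  have hslice : ∀ e : ι → ℝ, Measurable fun v => f (Function.update (e ∘ g) j v) := fun e =>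
    hf.comp (measurable_update _)
  rw [lintegral_clockLaw_update j hF, lintegral_clockLaw_update i]
  · have : ∀ (e : ι → ℝ) (u v : ℝ), {e : ι → ℝ | e i * β < e j * α}.indicator
        (fun e => f (Function.update (e ∘ g) j (e j - e i * β / α)))
        (Function.update (Function.update e i u) j v) =
        {v | u * β < v * α}.indicator
          (fun v => f (Function.update (e ∘ g) j (v - u * β / α))) v := by
      intro e u v
      simp only [Set.indicator, Set.mem_ofPred_eq, hu, Function.update_self,
        Function.update_of_ne hij]
    simp_rw [this]
    simp_rw [fun e : ι → ℝ => lintegral_race hα hβ (hslice e)]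
    have hm : Measurable fun e : ι → ℝ => ∫⁻ v, f (Function.update e j v) ∂expMeasure 1 :=
      Measurable.lintegral_prod_right'
        (f := fun q : (ι → ℝ) × ℝ => f (Function.update q.1 j q.2))
        (hf.comp ((measurable_update_prod j).comp measurable_swap))
    rw [lintegral_const_mul' _ _ ENNReal.ofReal_ne_top, lintegral_clockLaw_update j hf]
    exact congrArg _ (lintegral_clockLaw_comp hg hm)
  · exact Measurable.lintegral_prod_right'
      (f := fun q : (ι → ℝ) × ℝ => {e : ι → ℝ | e i * β < e j * α}.indicator
      (fun e => f (Function.update (e ∘ g) j (e j - e i * β / α))) (Function.update q.1 j q.2))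
      (hF.comp ((measurable_update_prod j).comp measurable_swap))

/-- A race in which both clocks are replaced by fresh ones. -/
theorem lintegral_race_fresh {i j : ι} (hij : i ≠ j) {g : ι → ι} (hg : Function.Injective g)
    (hi : ∀ k, g k ≠ i) (hj : ∀ k, g k ≠ j) {α β : ℝ} (hα : 0 ≤ α) (hβ : 0 ≤ β)
    {f : (ι → ℝ) → ENNReal} (hf : Measurable f) :
    ∫⁻ e, {e : ι → ℝ | e i * β < e j * α}.indicator (fun e => f (e ∘ g)) e ∂clockLaw ι =
      ENNReal.ofReal (α / (α + β)) * ∫⁻ e, f e ∂clockLaw ι := by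
  have hcomp : Measurable fun e : ι → ℝ => e ∘ g :=
    measurable_pi_lambda _ fun i => measurable_pi_apply _
  have hms : MeasurableSet {e : ι → ℝ | e i * β < e j * α} :=
    measurableSet_lt (by fun_prop) (by fun_prop)
  -- A direction of weight `0`, as beyond a reflecting end point, wins only if `e i * β < 0`, which
  -- is a null event.
  rcases hα.eq_or_lt with rfl | hα
  · simp only [mul_zero, zero_div, ENNReal.ofReal_zero, zero_mul]
    refine (lintegral_congr_ae ?_).trans lintegral_zero
    filter_upwards [ae_clockLaw_pos i] with e he
    exact Set.indicator_of_notMem (by simpa using mul_nonneg he.le hβ) _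
  have hF : Measurable ({e : ι → ℝ | e i * β < e j * α}.indicator (fun e => f (e ∘ g))) :=
    Measurable.indicator (hf.comp hcomp) hms
  have hu : ∀ (e : ι → ℝ) (u v : ℝ),
      (Function.update (Function.update e i u) j v ∘ g) = e ∘ g := by
    intro e u v
    ext k
    simp [Function.update_of_ne (hi k), Function.update_of_ne (hj k)]
  rw [lintegral_clockLaw_update j hF, lintegral_clockLaw_update i]
  · have : ∀ (e : ι → ℝ) (u v : ℝ), {e : ι → ℝ | e i * β < e j * α}.indicator
        (fun e => f (e ∘ g)) (Function.update (Function.update e i u) j v) =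
        {v | u * β < v * α}.indicator (fun _ => f (e ∘ g)) v := by
      intro e u v
      simp only [Set.indicator, Set.mem_ofPred_eq, hu, Function.update_self,
        Function.update_of_ne hij]
    simp_rw [this]
    simp_rw [fun e : ι → ℝ => lintegral_race hα hβ (measurable_const (a := f (e ∘ g)))]
    simp only [lintegral_const, measure_univ, mul_one]
    rw [lintegral_const_mul' _ _ ENNReal.ofReal_ne_top, lintegral_clockLaw_comp hg hf]
  · exact Measurable.lintegral_prod_right'
      (f := fun q : (ι → ℝ) × ℝ => {e : ι → ℝ | e i * β < e j * α}.indicator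
      (fun e => f (e ∘ g)) (Function.update q.1 j q.2))
      (hF.comp ((measurable_update_prod j).comp measurable_swap))

end Product

/-! ### Construction of the walk from independent exponential clocks -/

/-- The index set of the clocks: each site carries a stack of clocks for the jumps to the right
(`true`) and another one for the jumps to the left (`false`). -/
abbrev ClockIndex : Type := ℤ × Bool × ℕ

/-- Remove the top clock of the stack of the site `y` in the direction `s`. -/
def popOne (y : ℤ) (s : Bool) (i : ClockIndex) : ClockIndex :=
  if i.1 = y ∧ i.2.1 = s then (i.1, i.2.1, i.2.2 + 1) else i

/-- Remove the top clocks of both stacks of the site `y`. -/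
def popBoth (y : ℤ) (i : ClockIndex) : ClockIndex :=
  if i.1 = y then (i.1, i.2.1, i.2.2 + 1) else i

theorem popOne_injective (y : ℤ) (s : Bool) : Function.Injective (popOne y s) := by
  rintro ⟨a, b, c⟩ ⟨a', b', c'⟩ h
  unfold popOne at h
  grind

theorem popBoth_injective (y : ℤ) : Function.Injective (popBoth y) := by
  rintro ⟨a, b, c⟩ ⟨a', b', c'⟩ h
  unfold popBoth at h
  grind

theorem popOne_ne (y : ℤ) (s : Bool) (k : ClockIndex) : popOne y s k ≠ (y, s, 0) := by
  obtain ⟨a, b, c⟩ := k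
  unfold popOne
  grind

theorem popBoth_ne (y : ℤ) (s : Bool) (k : ClockIndex) : popBoth y k ≠ (y, s, 0) := by
  obtain ⟨a, b, c⟩ := k
  unfold popBoth
  grind

open Classical in
/-- The weight of the site `y` when the local times are `z`. -/
noncomputable def siteWeight (w : ℕ → ℝ) (I : Set ℤ) (z : ℤ → ℕ) (y : ℤ) : ℝ :=
  if y ∈ I then w (z y) else 0

/-- The probability to jump from `x` to `y` when the local times are `z`. -/
noncomputable def jumpProb (w : ℕ → ℝ) (I : Set ℤ) (x : ℤ) (z : ℤ → ℕ) (y : ℤ) : ℝ :=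
  if y = x + 1 then
    siteWeight w I z (x + 1) / (siteWeight w I z (x + 1) + siteWeight w I z (x - 1))
  else if y = x - 1 then
    siteWeight w I z (x - 1) / (siteWeight w I z (x + 1) + siteWeight w I z (x - 1))
  else 0

/-- Position, local times and clocks of a walk. -/
abbrev State : Type := ℤ × (ℤ → ℕ) × (ClockIndex → ℝ)

/-- The local times after a visit to `y`. -/
def bump (z : ℤ → ℕ) (y : ℤ) : ℤ → ℕ := Function.update z y (z y + 1)

/-- The clocks after a race at `x` won by the direction `s`, where `α` is the weight of the winning
neighbour and `β` the weight of the other one. At the origin the losing clock keeps running. -/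
noncomputable def nextClocks (x : ℤ) (s : Bool) (α β : ℝ) (e : ClockIndex → ℝ) : ClockIndex → ℝ :=
  if x = 0 then
    Function.update (e ∘ popOne 0 s) (0, !s, 0) (e (0, !s, 0) - e (0, s, 0) * β / α)
  else e ∘ popBoth x

open Classical in
/-- One step of the walk. -/
noncomputable def step (w : ℕ → ℝ) (I : Set ℤ) (s : State) : State :=
  if s.2.2 (s.1, true, 0) * siteWeight w I s.2.1 (s.1 - 1) <
      s.2.2 (s.1, false, 0) * siteWeight w I s.2.1 (s.1 + 1) then
    (s.1 + 1, bump s.2.1 (s.1 + 1), nextClocks s.1 true (siteWeight w I s.2.1 (s.1 + 1))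
      (siteWeight w I s.2.1 (s.1 - 1)) s.2.2)
  else
    (s.1 - 1, bump s.2.1 (s.1 - 1), nextClocks s.1 false (siteWeight w I s.2.1 (s.1 - 1))
      (siteWeight w I s.2.1 (s.1 + 1)) s.2.2)

/-- The state of the walk at time `n`. -/
noncomputable def run (w : ℕ → ℝ) (I : Set ℤ) (s : State) (n : ℕ) : State := (step w I)^[n] s

theorem measurable_bump (y : ℤ) : Measurable fun z => bump z y := by
  refine measurable_pi_lambda _ fun y' => ?_
  unfold bump
  by_cases h : y' = y
  · subst h
    simp only [Function.update_self]
    fun_prop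
  · simp only [Function.update_of_ne h]
    fun_prop

theorem measurable_siteWeight (w : ℕ → ℝ) (I : Set ℤ) (y : ℤ) :
    Measurable fun z => siteWeight w I z y := by
  unfold siteWeight
  split_ifs
  · exact (measurable_of_countable w).comp (measurable_pi_apply y)
  · exact measurable_const

theorem measurable_nextClocks (x : ℤ) (s : Bool) :
    Measurable fun q : ℝ × ℝ × (ClockIndex → ℝ) => nextClocks x s q.1 q.2.1 q.2.2 := by
  unfold nextClocks
  split_ifs
  · refine (measurable_update_prod _).comp (Measurable.prodMk (by fun_prop) ?_)
    exact measurable_pi_lambda _ fun i => (measurable_pi_apply _).comp (measurable_snd.comp measurable_snd)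
  · exact measurable_pi_lambda _ fun i => (measurable_pi_apply _).comp (measurable_snd.comp measurable_snd)

theorem measurable_step (w : ℕ → ℝ) (I : Set ℤ) : Measurable (step w I) := by
  refine measurable_from_prod_countable_right fun x => ?_
  have h1 : Measurable fun q : (ℤ → ℕ) × (ClockIndex → ℝ) => siteWeight w I q.1 (x + 1) :=
    (measurable_siteWeight w I _).comp measurable_fst
  have h2 : Measurable fun q : (ℤ → ℕ) × (ClockIndex → ℝ) => siteWeight w I q.1 (x - 1) :=
    (measurable_siteWeight w I _).comp measurable_fst
  have h3 : ∀ i, Measurable fun q : (ℤ → ℕ) × (ClockIndex → ℝ) => q.2 i := fun i =>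
    (measurable_pi_apply i).comp measurable_snd
  unfold step
  dsimp only
  refine Measurable.ite (measurableSet_lt ((h3 _).mul h2) ((h3 _).mul h1)) ?_ ?_
  · exact measurable_const.prodMk (((measurable_bump _).comp measurable_fst).prodMk
      ((measurable_nextClocks x true).comp (h1.prodMk (h2.prodMk measurable_snd))))
  · exact measurable_const.prodMk (((measurable_bump _).comp measurable_fst).prodMk
      ((measurable_nextClocks x false).comp (h2.prodMk (h1.prodMk measurable_snd))))

theorem measurable_run (w : ℕ → ℝ) (I : Set ℤ) (x : ℤ) (z : ℤ → ℕ) (n : ℕ) :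
    Measurable fun e => run w I (x, z, e) n :=
  ((measurable_step w I).iterate n).comp
    (measurable_const.prodMk (measurable_const.prodMk measurable_id))

/-- The path of the walk started from `0` with initial local times `z₀`. -/
noncomputable def walk (w : ℕ → ℝ) (I : Set ℤ) (z₀ : ℤ → ℕ) (e : ClockIndex → ℝ) (n : ℕ) : ℤ :=
  (run w I (0, bump z₀ 0, e) n).1

theorem measurable_walk (w : ℕ → ℝ) (I : Set ℤ) (z₀ : ℤ → ℕ) : Measurable (walk w I z₀) :=
  measurable_pi_lambda _ fun n => measurable_fst.comp (measurable_run w I _ _ n)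

/-! ### The law of the constructed walk -/

/-- A set of sites on which the walk can move. -/
structure Walkable (I : Set ℤ) : Prop where
  one_mem : (1 : ℤ) ∈ I
  zero_mem : (0 : ℤ) ∈ I
  neg_one_mem : (-1 : ℤ) ∈ I
  exists_neighbour : ∀ x ∈ I, x + 1 ∈ I ∨ x - 1 ∈ I

theorem siteWeight_nonneg {w : ℕ → ℝ} (hw : ∀ n, 0 < w n) (I : Set ℤ) (z : ℤ → ℕ) (y : ℤ) :
    0 ≤ siteWeight w I z y := by
  unfold siteWeight
  split_ifs
  · exact (hw _).le
  · exact le_rfl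

theorem siteWeight_pos {w : ℕ → ℝ} (hw : ∀ n, 0 < w n) {I : Set ℤ} (z : ℤ → ℕ) {y : ℤ}
    (hy : y ∈ I) : 0 < siteWeight w I z y := by
  unfold siteWeight
  rw [if_pos hy]
  exact hw _

theorem siteWeight_of_notMem (w : ℕ → ℝ) {I : Set ℤ} (z : ℤ → ℕ) {y : ℤ}
    (hy : y ∉ I) : siteWeight w I z y = 0 := if_neg hy

theorem siteWeight_ne_zero {w : ℕ → ℝ} (hw : ∀ n, 0 < w n) {I : Set ℤ} (hI : Walkable I)
    (z : ℤ → ℕ) {x : ℤ} (hx : x ∈ I) :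
    siteWeight w I z (x + 1) ≠ 0 ∨ siteWeight w I z (x - 1) ≠ 0 :=
  (hI.exists_neighbour x hx).imp (fun h => (siteWeight_pos hw z h).ne')
    fun h => (siteWeight_pos hw z h).ne'

theorem jumpProb_of_notMem (w : ℕ → ℝ) {I : Set ℤ} (x : ℤ) (z : ℤ → ℕ) {y : ℤ}
    (hy : y ∉ I) : jumpProb w I x z y = 0 := by
  unfold jumpProb
  split_ifs with h1 h2
  · rw [← h1, siteWeight_of_notMem w z hy, zero_div]
  · rw [← h2, siteWeight_of_notMem w z hy, zero_div]
  · rfl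

theorem lintegral_nextClocks {x : ℤ} (s : Bool) {α β : ℝ} (hα : 0 ≤ α) (hβ : 0 ≤ β)
    (h0 : x = 0 → 0 < α) {f : (ClockIndex → ℝ) → ENNReal} (hf : Measurable f) :
    ∫⁻ e, {e : ClockIndex → ℝ | e (x, s, 0) * β < e (x, !s, 0) * α}.indicator
      (fun e => f (nextClocks x s α β e)) e ∂clockLaw ClockIndex =
      ENNReal.ofReal (α / (α + β)) * ∫⁻ e, f e ∂clockLaw ClockIndex := by
  have hij : ((x, s, 0) : ClockIndex) ≠ (x, !s, 0) := by simp
  by_cases hx : x = 0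
  · subst hx
    simp only [nextClocks, if_true]
    exact lintegral_race_residual hij (popOne_injective 0 s) (popOne_ne 0 s)
      (by simp [popOne]) (h0 rfl) hβ hf
  · simp only [nextClocks, if_neg hx]
    exact lintegral_race_fresh hij (popBoth_injective x) (popBoth_ne x s) (popBoth_ne x _) hα hβ hf

/-- One step of the Markov property: given the direction of the jump, the remaining clocks have
their original law. Races are compared after cross-multiplication, so a neighbour of weight `0`
loses without any division. -/
theorem lintegral_step {w : ℕ → ℝ} (hw : ∀ n, 0 < w n) {I : Set ℤ} (hI : Walkable I) {x : ℤ}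
    (hx : x ∈ I) (z : ℤ → ℕ) (y : ℤ) {f : (ClockIndex → ℝ) → ENNReal} (hf : Measurable f) :
    ∫⁻ e, {e | (step w I (x, z, e)).1 = y}.indicator (fun e => f (step w I (x, z, e)).2.2) e
      ∂clockLaw ClockIndex =
      ENNReal.ofReal (jumpProb w I x z y) * ∫⁻ e, f e ∂clockLaw ClockIndex := by
  have hα := siteWeight_nonneg hw I z (x + 1)
  have hβ := siteWeight_nonneg hw I z (x - 1)
  unfold jumpProb
  split_ifs with h1 h2
  · subst h1
    rw [← lintegral_nextClocks (x := x) true hα hβ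
      (fun h => siteWeight_pos hw z (by rw [h]; exact hI.one_mem)) hf]
    refine lintegral_congr fun e => ?_
    by_cases hlt : e (x, true, 0) * siteWeight w I z (x - 1) <
      e (x, false, 0) * siteWeight w I z (x + 1)
    · rw [Set.indicator_of_mem (by simp [step, hlt]), Set.indicator_of_mem (by simpa using hlt)]
      simp [step, hlt]
    · rw [Set.indicator_of_notMem (by simp [step, hlt]; omega),
        Set.indicator_of_notMem (by simpa using hlt)]
  · subst h2
    rw [add_comm, ← lintegral_nextClocks (x := x) false hβ hα
      (fun h => siteWeight_pos hw z (by rw [h]; exact hI.neg_one_mem)) hf]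
    refine lintegral_congr_ae ?_
    -- `step` sends ties to the left, while the race formula wants a strict inequality; ties are
    -- null because one of the weights is nonzero.
    filter_upwards [ae_clockLaw_ne (i := (x, true, 0)) (j := (x, false, 0)) (by simp)
      (siteWeight_ne_zero hw hI z hx)] with e he
    rcases lt_or_gt_of_ne he with hlt | hlt
    · rw [Set.indicator_of_notMem (by simp [step, hlt]; omega),
        Set.indicator_of_notMem (by simpa using hlt.le)]
    · rw [Set.indicator_of_mem (by simp [step, hlt.not_gt]),
        Set.indicator_of_mem (by simpa using hlt)]
      simp [step, hlt.not_gt]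
  · rw [ENNReal.ofReal_zero, zero_mul]
    refine (lintegral_congr fun e => ?_).trans lintegral_zero
    refine Set.indicator_of_notMem ?_ _
    rw [Set.mem_ofPred_eq]
    unfold step
    split_ifs <;> simp only <;> omega

/-- The local times along the path `a`, started from the local times `z`. -/
def pathTime (z : ℤ → ℕ) (a : ℕ → ℤ) (n : ℕ) (y : ℤ) : ℕ :=
  z y + ∑ k ∈ Finset.range n, if a (k + 1) = y then 1 else 0

theorem pathTime_bump (z : ℤ → ℕ) (a : ℕ → ℤ) (n : ℕ) :
    pathTime (bump z (a 1)) (fun k => a (k + 1)) n = pathTime z a (n + 1) := by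
  ext y
  simp only [pathTime, bump, Finset.sum_range_succ']
  by_cases h : y = a 1
  · subst h
    simp
    ring
  · simp [Function.update_of_ne h, Ne.symm h]

/-- Induction from the front: after its first step the walk restarts from `a 1` with updated local
times and clocks of unchanged law. The starting site and local times must therefore stay general. -/
theorem clockLaw_run {w : ℕ → ℝ} (hw : ∀ n, 0 < w n) {I : Set ℤ} (hI : Walkable I) (n : ℕ)
    (a : ℕ → ℤ) {x : ℤ} (hx : x ∈ I) (z : ℤ → ℕ) :
    clockLaw ClockIndex {e | ∀ k ≤ n, (run w I (x, z, e) k).1 = a k} =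
      if x = a 0 then
        ∏ k ∈ Finset.range n, ENNReal.ofReal (jumpProb w I (a k) (pathTime z a k) (a (k + 1)))
      else 0 := by
  induction n generalizing a x z with
  | zero =>
    by_cases h : x = a 0 <;> simp [run, h]
  | succ n ih =>
    by_cases h : x = a 0
    · rw [if_pos h]
      subst h
      set S : Set (ClockIndex → ℝ) :=
        {e | ∀ k ≤ n, (run w I (a 1, bump z (a 1), e) k).1 = a (k + 1)} with hS
      have hSm : MeasurableSet S := by
        have : S = ⋂ k ≤ n, {e | (run w I (a 1, bump z (a 1), e) k).1 = a (k + 1)} := by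
          ext e
          simp [hS]
        rw [this]
        exact MeasurableSet.biInter (Set.to_countable _) fun k _ =>
          measurable_fst.comp (measurable_run w I _ _ k) (measurableSet_singleton _)
      have hfst : MeasurableSet {e | (step w I (a 0, z, e)).1 = a 1} :=
        measurable_fst.comp (measurable_run w I (a 0) z 1) (measurableSet_singleton _)
      have heq : {e | ∀ k ≤ n + 1, (run w I (a 0, z, e) k).1 = a k} =
          {e | (step w I (a 0, z, e)).1 = a 1} ∩ {e | (step w I (a 0, z, e)).2.2 ∈ S} := by
        ext e
        have hstep : (step w I (a 0, z, e)).1 = a 1 →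
            step w I (a 0, z, e) = (a 1, bump z (a 1), (step w I (a 0, z, e)).2.2) := by
          intro h1
          rw [← h1]
          unfold step
          split_ifs <;> rfl
        constructor
        · intro h
          have h1 : (step w I (a 0, z, e)).1 = a 1 := h 1 (by omega)
          refine ⟨h1, fun k hk => ?_⟩
          rw [← hstep h1]
          exact h (k + 1) (by omega)
        · rintro ⟨h1, h2⟩ k hk
          rcases k with _ | k
          · rfl
          · have := h2 k (by omega)
            rwa [← hstep h1] at this
      have hmeas : MeasurableSet {e | (step w I (a 0, z, e)).2.2 ∈ S} :=
        (measurable_snd.comp (measurable_snd.comp (measurable_run w I (a 0) z 1))) hSm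
      rw [heq, ← lintegral_indicator_one (hfst.inter hmeas)]
      have := lintegral_step hw hI hx z (a 1) (f := S.indicator 1) (measurable_one.indicator hSm)
      rw [lintegral_indicator_one hSm] at this
      rw [Finset.prod_range_succ']
      have hz : pathTime z a 0 = z := by
        ext y
        simp [pathTime]
      rw [hz, mul_comm, zero_add]
      refine Eq.trans (lintegral_congr fun e => ?_) (this.trans ?_)
      · by_cases h1 : e ∈ {e | (step w I (a 0, z, e)).1 = a 1}
        · rw [Set.indicator_of_mem h1]
          by_cases h2 : (step w I (a 0, z, e)).2.2 ∈ S
          · rw [Set.indicator_of_mem h2, Set.indicator_of_mem (Set.mem_inter h1 h2)]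
            rfl
          · rw [Set.indicator_of_notMem h2, Set.indicator_of_notMem fun h => h2 h.2]
        · rw [Set.indicator_of_notMem h1, Set.indicator_of_notMem fun h => h1 h.1]
      · by_cases ha : a 1 ∈ I
        · rw [ih (fun k => a (k + 1)) ha (bump z (a 1)), if_pos rfl]
          simp only [pathTime_bump]
        · rw [jumpProb_of_notMem w _ _ ha, ENNReal.ofReal_zero, zero_mul, zero_mul]
    · rw [if_neg h]
      convert measure_empty (μ := clockLaw ClockIndex)
      ext e
      simp only [Set.mem_ofPred_eq, Set.mem_empty_iff_false, iff_false, not_forall]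
      exact ⟨0, by omega, h⟩

/-! ### Uniqueness of the law of the walk -/

/-- The set of paths which coincide with `a` up to time `n`. -/
def pathCylinder (a : ℕ → ℤ) (n : ℕ) : Set (ℕ → ℤ) := {x | ∀ k ≤ n, x k = a k}

theorem measurableSet_pathCylinder (a : ℕ → ℤ) (n : ℕ) : MeasurableSet (pathCylinder a n) := by
  have : pathCylinder a n = ⋂ k ≤ n, (fun x : ℕ → ℤ => x k) ⁻¹' {a k} := by
    ext x
    simp [pathCylinder]
  rw [this]
  exact MeasurableSet.biInter (Set.to_countable _) fun k _ =>
    measurable_pi_apply k (measurableSet_singleton _)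

theorem generateFrom_pathCylinder :
    (inferInstance : MeasurableSpace (ℕ → ℤ)) =
      MeasurableSpace.generateFrom {s | ∃ a n, s = pathCylinder a n} := by
  refine le_antisymm ?_ (MeasurableSpace.generateFrom_le ?_)
  · refine iSup_le fun k => ?_
    rintro _ ⟨t, -, rfl⟩
    rw [← Set.biUnion_preimage_singleton]
    refine MeasurableSet.biUnion t.to_countable fun y _ => ?_
    have : (fun x : ℕ → ℤ => x k) ⁻¹' {y} =
        ⋃ (b : Fin (k + 1) → ℤ) (_ : b (Fin.last k) = y),
          pathCylinder (fun i => if h : i < k + 1 then b ⟨i, h⟩ else 0) k := by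
      ext x
      simp only [Set.mem_preimage, Set.mem_singleton_iff, Set.mem_iUnion, pathCylinder,
        Set.mem_ofPred_eq, exists_prop]
      constructor
      · intro hx
        refine ⟨fun i => x i, hx, fun i hi => ?_⟩
        rw [dif_pos (by omega)]
      · rintro ⟨b, hb, hx⟩
        rw [hx k le_rfl, dif_pos (by omega)]
        exact hb
    rw [this]
    refine MeasurableSet.iUnion fun b => MeasurableSet.iUnion fun _ => ?_
    exact MeasurableSpace.measurableSet_generateFrom ⟨_, _, rfl⟩
  · rintro _ ⟨a, n, rfl⟩
    exact measurableSet_pathCylinder a n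

theorem isPiSystem_pathCylinder : IsPiSystem {s | ∃ a n, s = pathCylinder a n} := by
  rintro _ ⟨a, n, rfl⟩ _ ⟨b, m, rfl⟩ ⟨c, hc, hc'⟩
  refine ⟨c, max n m, ?_⟩
  ext x
  constructor
  · rintro ⟨h1, h2⟩ k hk
    rcases le_max_iff.1 hk with h | h
    · rw [h1 k h, hc k h]
    · rw [h2 k h, hc' k h]
  · intro h
    exact ⟨fun k hk => (h k (le_max_of_le_left hk)).trans (hc k hk),
      fun k hk => (h k (le_max_of_le_right hk)).trans (hc' k hk)⟩

theorem measure_eq_of_pathCylinder {μ ν : Measure (ℕ → ℤ)} [IsProbabilityMeasure μ]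
    [IsProbabilityMeasure ν] (h : ∀ a n, μ (pathCylinder a n) = ν (pathCylinder a n)) : μ = ν := by
  refine ext_of_generate_finite _ generateFrom_pathCylinder isPiSystem_pathCylinder ?_ (by simp)
  rintro _ ⟨a, n, rfl⟩
  exact h a n

/-! ### Cylinder probabilities of an arbitrary vertex reinforced random walk -/

section Law

variable {Ω : Type*}

theorem localTime_eq_pathTime {z₀ : ℤ → ℕ} {X : ℕ → Ω → ℤ} {a : ℕ → ℤ} {n : ℕ} {ω : Ω}
    (ha : a 0 = 0) (h : ∀ k ≤ n, X k ω = a k) (y : ℤ) :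
    localTime z₀ X n y ω = pathTime (bump z₀ 0) a n y := by
  have h1 : ∀ k ∈ Finset.range (n + 1), (if X k ω = y then 1 else 0) =
      if a k = y then 1 else 0 := fun k hk => by
    rw [h k (by simpa [Nat.lt_succ_iff] using hk)]
  unfold localTime pathTime bump
  rw [Finset.sum_congr rfl h1, Finset.sum_range_succ', ha]
  by_cases hy : y = 0
  · subst hy
    simp
    ring
  · simp [Function.update_of_ne hy, Ne.symm hy]

/-- On a path cylinder the conditional jump probability is constant; integrating over it turns the
definition of the walk into a product formula. -/
theorem measureReal_inter_of_condExp {m : MeasurableSpace Ω} {m0 : MeasurableSpace Ω}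
    {P : Measure Ω} [IsFiniteMeasure P]
    (hm : m ≤ m0) {A B : Set Ω} (hA : MeasurableSet[m] A) (hB : MeasurableSet B) {f : Ω → ℝ}
    (hf : P⟦B | m⟧ =ᵐ[P] f) {c : ℝ} (hc : ∀ ω ∈ A, f ω = c) :
    P.real (A ∩ B) = c * P.real A := by
  have h1 := setIntegral_condExp (μ := P) hm (f := B.indicator fun _ => (1 : ℝ))
    ((integrable_const (1 : ℝ)).indicator hB) hA
  rw [setIntegral_congr_ae (hm _ hA) (hf.mono fun ω h _ => h),
    setIntegral_congr_fun (hm _ hA) hc, setIntegral_indicator hB] at h1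
  simp only [integral_const, measureReal_restrict_apply MeasurableSet.univ, Set.univ_inter,
    smul_eq_mul, mul_one] at h1
  rw [← h1, mul_comm]

variable [MeasurableSpace Ω] {P : Measure Ω}
  {w : ℕ → ℝ} {z₀ : ℤ → ℕ} {I : Set ℤ} {X : ℕ → Ω → ℤ}

theorem IsVRRW.measurableSet_path (hX : IsVRRW P w z₀ I X) (a : ℕ → ℤ) (n : ℕ) :
    MeasurableSet[Filtration.natural X hX.stronglyMeasurable n] {ω | ∀ k ≤ n, X k ω = a k} := by
  have : {ω | ∀ k ≤ n, X k ω = a k} = ⋂ k ≤ n, X k ⁻¹' {a k} := by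
    ext ω
    simp
  rw [this]
  refine MeasurableSet.biInter (Set.to_countable _) fun k hk => ?_
  have h1 := (Filtration.stronglyAdapted_natural hX.stronglyMeasurable k).measurable
  exact (Filtration.natural X hX.stronglyMeasurable).mono hk _ (h1 (measurableSet_singleton _))

variable [IsProbabilityMeasure P]

theorem IsVRRW.measureReal_path_succ (hw : ∀ n, 0 < w n) (hI : Walkable I)
    (hX : IsVRRW P w z₀ I X) {a : ℕ → ℤ} (ha : a 0 = 0) {n : ℕ} (hn : a n ∈ I) :
    P.real {ω | ∀ k ≤ n + 1, X k ω = a k} =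
      jumpProb w I (a n) (pathTime (bump z₀ 0) a n) (a (n + 1)) *
        P.real {ω | ∀ k ≤ n, X k ω = a k} := by
  set A := {ω | ∀ k ≤ n, X k ω = a k} with hA
  set z := pathTime (bump z₀ 0) a n with hz
  have hmA := hX.measurableSet_path a n
  have hle := (Filtration.natural X hX.stronglyMeasurable).le n
  have hXm : ∀ k, Measurable (X k) := fun k => (hX.stronglyMeasurable k).measurable
  have hmR : MeasurableSet {ω | X (n + 1) ω = X n ω + 1} :=
    measurableSet_eq_fun (hXm _) ((hXm n).add_const 1)
  have hmL : MeasurableSet {ω | X (n + 1) ω = X n ω - 1} :=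
    measurableSet_eq_fun (hXm _) ((hXm n).sub_const 1)
  have hatt : ∀ ω ∈ A, ∀ y, attraction w z₀ I X n y ω = siteWeight w I z y := by
    intro ω hω y
    unfold attraction siteWeight
    rw [localTime_eq_pathTime ha hω]
  have hR := measureReal_inter_of_condExp hle hmA hmR (hX.step_right n)
    (c := siteWeight w I z (a n + 1) / (siteWeight w I z (a n + 1) + siteWeight w I z (a n - 1)))
    (fun ω hω => by rw [hatt ω hω, hatt ω hω, hω n le_rfl])
  have hL := measureReal_inter_of_condExp hle hmA hmL (hX.step_left n)
    (c := siteWeight w I z (a n - 1) / (siteWeight w I z (a n + 1) + siteWeight w I z (a n - 1)))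
    (fun ω hω => by rw [hatt ω hω, hatt ω hω, hω n le_rfl])
  have hsucc : {ω | ∀ k ≤ n + 1, X k ω = a k} = A ∩ {ω | X (n + 1) ω = a (n + 1)} := by
    ext ω
    constructor
    · exact fun h => ⟨fun k hk => h k (by omega), h (n + 1) le_rfl⟩
    · rintro ⟨h1, h2⟩ k hk
      rcases Nat.le_succ_iff.1 hk with h | rfl
      · exact h1 k h
      · exact h2
  rw [hsucc]
  unfold jumpProb
  split_ifs with h1 h2
  · rw [← hR]
    congr 1
    ext ω
    refine and_congr_right fun hω => ?_
    simp only [Set.mem_ofPred_eq]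
    rw [hω n le_rfl, h1]
  · rw [← hL]
    congr 1
    ext ω
    refine and_congr_right fun hω => ?_
    simp only [Set.mem_ofPred_eq]
    rw [hω n le_rfl, h2]
  -- Remaining case: `a (n + 1)` is not a neighbour of `a n`. The two conditional probabilities sum
  -- to `1`, so the jumps to the neighbours already exhaust the mass of `A`.
  · have hdisj : Disjoint (A ∩ {ω | X (n + 1) ω = X n ω + 1}) (A ∩ {ω | X (n + 1) ω = X n ω - 1}) := by
      rw [Set.disjoint_left]
      rintro ω ⟨-, h3⟩ ⟨-, h4⟩
      simp only [Set.mem_ofPred_eq] at h3 h4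
      omega
    have hne : siteWeight w I z (a n + 1) + siteWeight w I z (a n - 1) ≠ 0 := by
      have := siteWeight_nonneg hw I z (a n + 1)
      have := siteWeight_nonneg hw I z (a n - 1)
      intro h0
      rcases siteWeight_ne_zero hw hI z hn with h | h <;> apply h <;> linarith
    have hunion := measureReal_union (μ := P) hdisj ((hle _ hmA).inter hmL)
    rw [hR, hL, ← add_mul, ← add_div, div_self hne, one_mul] at hunion
    have hdisj' : Disjoint ((A ∩ {ω | X (n + 1) ω = X n ω + 1}) ∪
        (A ∩ {ω | X (n + 1) ω = X n ω - 1})) (A ∩ {ω | X (n + 1) ω = a (n + 1)}) := by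
      rw [Set.disjoint_left]
      rintro ω h3 ⟨h4, h5⟩
      have h6 := h4 n le_rfl
      rcases h3 with ⟨-, h3⟩ | ⟨-, h3⟩ <;> simp only [Set.mem_ofPred_eq] at h3 h5 <;> omega
    have hunion' := measureReal_union (μ := P) hdisj'
      ((hle _ hmA).inter (hXm _ (measurableSet_singleton _)))
    have hsub : P.real (((A ∩ {ω | X (n + 1) ω = X n ω + 1}) ∪
        (A ∩ {ω | X (n + 1) ω = X n ω - 1})) ∪ (A ∩ {ω | X (n + 1) ω = a (n + 1)})) ≤ P.real A :=
      measureReal_mono (Set.union_subset (Set.union_subset Set.inter_subset_left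
        Set.inter_subset_left) Set.inter_subset_left)
    rw [hunion', hunion] at hsub
    have := measureReal_nonneg (μ := P) (s := A ∩ {ω | X (n + 1) ω = a (n + 1)})
    linarith

theorem IsVRRW.measureReal_path (hw : ∀ n, 0 < w n) (hI : Walkable I)
    (hX : IsVRRW P w z₀ I X) (a : ℕ → ℤ) (n : ℕ) :
    P.real {ω | ∀ k ≤ n, X k ω = a k} = if 0 = a 0 then ∏ k ∈ Finset.range n,
      jumpProb w I (a k) (pathTime (bump z₀ 0) a k) (a (k + 1)) else 0 := by
  have hP0 : ∀ {s t : Set Ω}, s ⊆ t → P.real t = 0 → P.real s = 0 := fun h h0 =>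
    le_antisymm ((measureReal_mono h).trans h0.le) measureReal_nonneg
  by_cases ha : 0 = a 0
  · rw [if_pos ha]
    induction n with
    | zero =>
      rw [Finset.range_zero, Finset.prod_empty]
      have : {ω | ∀ k ≤ 0, X k ω = a k} =ᵐ[P] Set.univ := by
        refine eventuallyEq_univ.2 ?_
        filter_upwards [hX.start] with ω hω k hk
        rw [Nat.le_zero.1 hk, hω, ha]
      rw [measureReal_congr this, probReal_univ]
    | succ n ih =>
      rw [Finset.prod_range_succ, mul_comm]
      by_cases hn : a n ∈ I
      · rw [hX.measureReal_path_succ hw hI ha.symm hn, ih]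
      -- A path that stands outside `I` got there by a jump of probability `0`; it cannot start
      -- there since `0 ∈ I`.
      · have h0 : ∏ k ∈ Finset.range n,
            jumpProb w I (a k) (pathTime (bump z₀ 0) a k) (a (k + 1)) = 0 := by
          rcases n with _ | n
          · exact absurd hI.zero_mem (by rwa [ha])
          · rw [Finset.prod_range_succ, jumpProb_of_notMem w _ _ hn, mul_zero]
        rw [h0] at ih ⊢
        rw [mul_zero]
        exact hP0 (t := {ω | ∀ k ≤ n, X k ω = a k}) (fun ω h k hk => h k (by omega)) ih
  · rw [if_neg ha]
    have h0 : P.real {ω | X 0 ω ≠ 0} = 0 := by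
      rw [measureReal_def, ae_iff.1 hX.start, ENNReal.toReal_zero]
    refine hP0 (fun ω h => ?_) h0
    rw [Set.mem_ofPred_eq, h 0 (Nat.zero_le _)]
    exact Ne.symm ha

theorem jumpProb_nonneg (hw : ∀ n, 0 < w n) (I : Set ℤ) (x : ℤ) (z : ℤ → ℕ) (y : ℤ) :
    0 ≤ jumpProb w I x z y := by
  have h1 := siteWeight_nonneg hw I z (x + 1)
  have h2 := siteWeight_nonneg hw I z (x - 1)
  unfold jumpProb
  split_ifs <;> positivity

/-- Every vertex reinforced random walk has the law of the walk driven by exponential clocks. -/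
theorem IsVRRW.map_eq (hw : ∀ n, 0 < w n) (hI : Walkable I) (hX : IsVRRW P w z₀ I X) :
    P.map (fun ω n => X n ω) = (clockLaw ClockIndex).map (walk w I z₀) := by
  have hXm : Measurable fun ω n => X n ω :=
    measurable_pi_lambda _ fun k => (hX.stronglyMeasurable k).measurable
  have hWm := measurable_walk w I z₀
  have := Measure.isProbabilityMeasure_map (μ := P) hXm.aemeasurable
  have := Measure.isProbabilityMeasure_map (μ := clockLaw ClockIndex) hWm.aemeasurable
  refine measure_eq_of_pathCylinder fun a n => ?_
  rw [Measure.map_apply hXm (measurableSet_pathCylinder a n),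
    Measure.map_apply hWm (measurableSet_pathCylinder a n)]
  have h1 := hX.measureReal_path hw hI a n
  have h2 := clockLaw_run hw hI n a hI.zero_mem (bump z₀ 0)
  change P {ω | ∀ k ≤ n, X k ω = a k} =
    clockLaw ClockIndex {e | ∀ k ≤ n, (run w I (0, bump z₀ 0, e) k).1 = a k}
  rw [h2, ← ofReal_measureReal, h1]
  split_ifs
  · exact ENNReal.ofReal_prod_of_nonneg fun k _ => jumpProb_nonneg hw I _ _ _
  · exact ENNReal.ofReal_zero

end Law

/-! ### The clocks of the constructed walk -/

/-- The stack `E` of the clocks for the jumps of `p` from the origin to the right at time `n`, when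
a time `T` has been spent at the origin: the clock on top has been running, unless `p` is making an
excursion to the right. -/
structure StackInv (w : ℕ → ℝ) (c : ℕ) (R : ℕ → ℝ) (p : ℕ → ℤ) (n : ℕ) (E : ℕ → ℝ) (T : ℝ) :
    Prop where
  fresh : ∀ k, E (k + 1) = R (k + 1 + rightJumps p n 0)
  away : 1 ≤ p n → E 0 = R (rightJumps p n 0) ∧ clock w c R p n = T
  running : p n ≤ 0 → clock w c R p n = T + E 0 / w (c + visits p n 1)

section StackInv

variable {w : ℕ → ℝ} {c : ℕ} {R : ℕ → ℝ} {p : ℕ → ℤ} {n : ℕ} {E E' : ℕ → ℝ} {T : ℝ}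

theorem StackInv.init (hp : p 0 = 0) : StackInv w c R p 0 R 0 where
  fresh k := by simp
  away h := by omega
  running _ := by simp [clock]

/-- The winning clock rings after its residual divided by its rate, and this is the time that
elapses at the origin. -/
theorem StackInv.win (h : StackInv w c R p n E T) (h0 : p n = 0) (h1 : p (n + 1) = 1)
    (hE : ∀ k, E' k = E (k + 1)) :
    StackInv w c R p (n + 1) E' (T + E 0 / w (c + visits p n 1)) where
  fresh k := by
    rw [hE, h.fresh, rightJumps_succ, if_pos (by omega)]
    congr 1
    ring
  away _ := by
    rw [hE, h.fresh, rightJumps_succ, if_pos (by omega), clock_succ_of_not (by omega),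
      h.running h0.le]
    refine ⟨?_, rfl⟩
    congr 1
    ring
  running h2 := by omega

/-- During a time `t` the losing clock is used up by `t` times its rate, so its ringing time is
unchanged. -/
theorem StackInv.lose (h : StackInv w c R p n E T) (h0 : p n = 0) (h1 : p (n + 1) = -1) {t : ℝ}
    (hw : w (c + visits p n 1) ≠ 0) (hE0 : E' 0 = E 0 - t * w (c + visits p n 1))
    (hE : ∀ k, E' (k + 1) = E (k + 1)) :
    StackInv w c R p (n + 1) E' (T + t) where
  fresh k := by rw [hE, h.fresh, rightJumps_succ, if_neg (by omega), add_zero]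
  away h2 := by omega
  running _ := by
    rw [hE0, clock_succ_of_not (by omega), h.running h0.le, visits_succ, if_neg (by omega),
      add_zero, sub_div, mul_div_cancel_right₀ _ hw]
    ring

theorem StackInv.other (h : StackInv w c R p n E T) (hp : IsPath p) (h0 : p n ≠ 0) :
    StackInv w c R p (n + 1) E T where
  fresh k := by rw [h.fresh, rightJumps_succ, if_neg (by omega), add_zero]
  away h2 := by
    have := hp.step n
    rw [clock_succ_of_not (by omega), rightJumps_succ, if_neg (by omega), add_zero]
    exact h.away (by omega)
  running h2 := by
    -- On return from `1` a fresh clock starts at the updated weight; the balance of crossings shows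
    -- that `clock` and the stack give it the same index.
    by_cases h1 : p n = 1
    · have h3 := hp.step n
      have h4 : p (n + 1) = 0 := by omega
      have h5 := hp.flow_of_le le_rfl (n := n + 1) h4.le
      rw [rightJumps_succ, if_neg (by omega), add_zero, zero_add] at h5
      rw [clock_succ_of ⟨h1, h4⟩, ← h5, (h.away (by omega)).1, (h.away (by omega)).2]
    · have := hp.step n
      rw [clock_succ_of_not (by omega), visits_succ, if_neg h1, add_zero]
      exact h.running (by omega)

end StackInv

/-! ### Clock rule and coupling for the constructed walk -/

section Walk

variable {w : ℕ → ℝ} {I : Set ℤ} {z₀ : ℤ → ℕ} {e : ClockIndex → ℝ}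

/-- The local times of the constructed walk. -/
noncomputable def walkTimes (w : ℕ → ℝ) (I : Set ℤ) (z₀ : ℤ → ℕ) (e : ClockIndex → ℝ) (n : ℕ) :
    ℤ → ℕ := (run w I (0, bump z₀ 0, e) n).2.1

/-- The clocks of the constructed walk. -/
noncomputable def walkClocks (w : ℕ → ℝ) (I : Set ℤ) (z₀ : ℤ → ℕ) (e : ClockIndex → ℝ) (n : ℕ) :
    ClockIndex → ℝ := (run w I (0, bump z₀ 0, e) n).2.2

/-- The walk jumps to the right at time `n`. -/
def WinsRight (w : ℕ → ℝ) (I : Set ℤ) (z₀ : ℤ → ℕ) (e : ClockIndex → ℝ) (n : ℕ) : Prop :=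
  walkClocks w I z₀ e n (walk w I z₀ e n, true, 0) *
      siteWeight w I (walkTimes w I z₀ e n) (walk w I z₀ e n - 1) <
    walkClocks w I z₀ e n (walk w I z₀ e n, false, 0) *
      siteWeight w I (walkTimes w I z₀ e n) (walk w I z₀ e n + 1)

theorem run_succ (s : State) (n : ℕ) : run w I s (n + 1) = step w I (run w I s n) :=
  Function.iterate_succ_apply' _ _ _

theorem walk_of_wins {n : ℕ} (h : WinsRight w I z₀ e n) :
    walk w I z₀ e (n + 1) = walk w I z₀ e n + 1 ∧
    walkClocks w I z₀ e (n + 1) = nextClocks (walk w I z₀ e n) true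
      (siteWeight w I (walkTimes w I z₀ e n) (walk w I z₀ e n + 1))
      (siteWeight w I (walkTimes w I z₀ e n) (walk w I z₀ e n - 1)) (walkClocks w I z₀ e n) := by
  unfold WinsRight walkClocks walk walkTimes at *
  rw [run_succ]
  unfold step
  rw [if_pos h]
  exact ⟨rfl, rfl⟩

theorem walk_of_not_wins {n : ℕ} (h : ¬WinsRight w I z₀ e n) :
    walk w I z₀ e (n + 1) = walk w I z₀ e n - 1 ∧
    walkClocks w I z₀ e (n + 1) = nextClocks (walk w I z₀ e n) false
      (siteWeight w I (walkTimes w I z₀ e n) (walk w I z₀ e n - 1))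
      (siteWeight w I (walkTimes w I z₀ e n) (walk w I z₀ e n + 1)) (walkClocks w I z₀ e n) := by
  unfold WinsRight walkClocks walk walkTimes at *
  rw [run_succ]
  unfold step
  rw [if_neg h]
  exact ⟨rfl, rfl⟩

theorem walkTimes_succ (n : ℕ) : walkTimes w I z₀ e (n + 1) =
    bump (walkTimes w I z₀ e n) (walk w I z₀ e (n + 1)) := by
  unfold walkTimes walk
  rw [run_succ]
  unfold step
  split_ifs <;> rfl

theorem isPath_walk (w : ℕ → ℝ) (I : Set ℤ) (z₀ : ℤ → ℕ) (e : ClockIndex → ℝ) :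
    IsPath (walk w I z₀ e) := by
  refine ⟨rfl, fun n => ?_⟩
  by_cases h : WinsRight w I z₀ e n
  · exact Or.inl (walk_of_wins h).1
  · exact Or.inr (walk_of_not_wins h).1

theorem winsRight_iff {n : ℕ} :
    WinsRight w I z₀ e n ↔ walk w I z₀ e (n + 1) = walk w I z₀ e n + 1 := by
  refine ⟨fun h => (walk_of_wins h).1, fun h => ?_⟩
  by_contra h'
  have := (walk_of_not_wins h').1
  omega

theorem walkTimes_eq (n : ℕ) (y : ℤ) :
    walkTimes w I z₀ e n y = z₀ y + visits (walk w I z₀ e) (n + 1) y := by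
  induction n with
  | zero =>
    change bump z₀ 0 y = _
    rw [visits_succ, visits_zero, (isPath_walk w I z₀ e).start]
    unfold bump
    by_cases h : y = 0
    · subst h
      simp
    · simp [Function.update_of_ne h, Ne.symm h]
  | succ n ih =>
    rw [walkTimes_succ, visits_succ]
    unfold bump
    by_cases h : y = walk w I z₀ e (n + 1)
    · rw [← h, Function.update_self, if_pos rfl, ih, add_assoc]
    · rw [Function.update_of_ne h, if_neg (Ne.symm h), ih, add_zero]

theorem walkTimes_of_ne {n : ℕ} {y : ℤ} (h : walk w I z₀ e n ≠ y) :
    walkTimes w I z₀ e n y = z₀ y + visits (walk w I z₀ e) n y := by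
  rw [walkTimes_eq, visits_succ, if_neg h, add_zero]

/-- Both stacks are popped at every visit, so the pair of clocks in use depends only on the rank of
the visit. This is what makes arrows of two paths comparable. -/
theorem walkClocks_of_ne_zero (n : ℕ) {x : ℤ} (hx : x ≠ 0) (s : Bool) (k : ℕ) :
    walkClocks w I z₀ e n (x, s, k) = e (x, s, k + visits (walk w I z₀ e) n x) := by
  induction n generalizing k with
  | zero => rfl
  | succ n ih =>
    have key : ∀ (s' : Bool) (α β : ℝ), nextClocks (walk w I z₀ e n) s' α β (walkClocks w I z₀ e n)
        (x, s, k) = e (x, s, k + visits (walk w I z₀ e) (n + 1) x) := by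
      intro s' α β
      unfold nextClocks
      rw [visits_succ]
      by_cases h0 : walk w I z₀ e n = 0
      · rw [if_pos h0, Function.update_of_ne (by simp [hx]), if_neg (by omega)]
        simp [popOne, hx, ih]
      · rw [if_neg h0]
        by_cases h1 : walk w I z₀ e n = x
        · simp [popBoth, h1, ih]
          congr 3
          ring
        · simp [popBoth, h1, Ne.symm h1, ih]
    by_cases h : WinsRight w I z₀ e n
    · rw [(walk_of_wins h).2, key]
    · rw [(walk_of_not_wins h).2, key]

/-- One `T` serves both sides, since the time taken by the winner is exactly the time charged to the
loser. -/
theorem stackInv_walk (hw : ∀ n, 0 < w n) (hI : Walkable I) (n : ℕ) :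
    ∃ T, StackInv w (z₀ 1) (fun k => e (0, true, k)) (walk w I z₀ e) n
        (fun k => walkClocks w I z₀ e n (0, true, k)) T ∧
      StackInv w (z₀ (-1)) (fun k => e (0, false, k)) (-walk w I z₀ e) n
        (fun k => walkClocks w I z₀ e n (0, false, k)) T := by
  have hp := isPath_walk w I z₀ e
  induction n with
  | zero => exact ⟨0, .init hp.start, .init hp.neg.start⟩
  | succ n ih =>
    obtain ⟨T, hR, hL⟩ := ih
    by_cases h0 : walk w I z₀ e n = 0
    · have hα : siteWeight w I (walkTimes w I z₀ e n) 1 =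
          w (z₀ 1 + visits (walk w I z₀ e) n 1) := by
        rw [← walkTimes_of_ne (by omega)]
        exact if_pos hI.one_mem
      have hβ : siteWeight w I (walkTimes w I z₀ e n) (-1) =
          w (z₀ (-1) + visits (-walk w I z₀ e) n 1) := by
        rw [visits_neg, ← walkTimes_of_ne (by omega)]
        exact if_pos hI.neg_one_mem
      have hα0 := hw (z₀ 1 + visits (walk w I z₀ e) n 1)
      have hβ0 := hw (z₀ (-1) + visits (-walk w I z₀ e) n 1)
      by_cases h : WinsRight w I z₀ e n
      · obtain ⟨h1, h2⟩ := walk_of_wins h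
        rw [h0, zero_add, zero_sub, hα, hβ] at h2
        refine ⟨_, hR.win h0 (by omega) fun k => ?_, hL.lose (by simp [h0]) (by simp [h1, h0])
          hβ0.ne' ?_ fun k => ?_⟩
        · simp [h2, nextClocks, popOne]
        · simp [h2, nextClocks]
          ring
        · simp [h2, nextClocks, popOne]
      · obtain ⟨h1, h2⟩ := walk_of_not_wins h
        rw [h0, zero_add, zero_sub, hα, hβ] at h2
        refine ⟨_, hR.lose h0 (by omega) hα0.ne' ?_ fun k => ?_, hL.win (by simp [h0])
          (by simp [h1, h0]) fun k => ?_⟩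
        · simp [h2, nextClocks]
          ring
        · simp [h2, nextClocks, popOne]
        · simp [h2, nextClocks, popOne]
    · have hc : ∀ s k, walkClocks w I z₀ e (n + 1) (0, s, k) = walkClocks w I z₀ e n (0, s, k) := by
        intro s k
        by_cases h : WinsRight w I z₀ e n
        · simp [(walk_of_wins h).2, nextClocks, h0, popBoth, Ne.symm h0]
        · simp [(walk_of_not_wins h).2, nextClocks, h0, popBoth, Ne.symm h0]
      simp only [hc]
      exact ⟨T, hR.other hp h0, hL.other hp.neg (by simpa using h0)⟩

theorem clockRule_walk (hw : ∀ n, 0 < w n) (hI : Walkable I) :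
    ClockRule w (z₀ 1) (z₀ (-1)) (fun k => e (0, true, k)) (fun k => e (0, false, k))
      (walk w I z₀ e) := by
  have key : ∀ n, walk w I z₀ e n = 0 → ∃ u v α β T : ℝ, 0 < α ∧ 0 < β ∧
      clock w (z₀ 1) (fun k => e (0, true, k)) (walk w I z₀ e) n = T + u / α ∧
      clock w (z₀ (-1)) (fun k => e (0, false, k)) (-walk w I z₀ e) n = T + v / β ∧
      (WinsRight w I z₀ e n ↔ u * β < v * α) := by
    intro n h0
    obtain ⟨T, hR, hL⟩ := stackInv_walk (z₀ := z₀) (e := e) hw hI n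
    refine ⟨_, _, _, _, T, hw _, hw _, hR.running h0.le, hL.running (by simp [h0]), ?_⟩
    unfold WinsRight
    rw [h0, zero_add, zero_sub, visits_neg, ← walkTimes_of_ne (by omega),
      ← walkTimes_of_ne (by omega)]
    unfold siteWeight
    rw [if_pos hI.one_mem, if_pos hI.neg_one_mem]
  constructor
  · intro n h0 h1
    obtain ⟨u, v, α, β, T, hα, hβ, hR, hL, hiff⟩ := key n h0
    have := hiff.1 (winsRight_iff.2 (by omega))
    rw [hR, hL]
    have := (div_lt_div_iff₀ hα hβ).2 this
    linarith
  · intro n h0 h1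
    obtain ⟨u, v, α, β, T, hα, hβ, hR, hL, hiff⟩ := key n h0
    have : ¬u * β < v * α := fun h => by
      have := winsRight_iff.1 (hiff.2 h)
      omega
    rw [hR, hL]
    have := (div_le_div_iff₀ hβ hα).2 (not_lt.1 this)
    linarith

theorem siteWeight_mono (hmono : Monotone w) {z z' : ℤ → ℕ} {y : ℤ} (h : z y ≤ z' y) :
    siteWeight w I z y ≤ siteWeight w I z' y := by
  unfold siteWeight
  split_ifs
  · exact hmono h
  · exact le_rfl

/-- Shortening the first clock for the jumps from the origin to the right pushes the walk to the
right. -/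
theorem coupled_walk (hw : ∀ n, 0 < w n) (hmono : Monotone w) (hI : Walkable I)
    {e' : ClockIndex → ℝ} (he : ∀ i, 0 ≤ e i) (he' : ∀ i, 0 ≤ e' i)
    (hlt : e' (0, true, 0) < e (0, true, 0))
    (heq : ∀ i, i ≠ (0, true, 0) → e' i = e i) :
    Coupled w (z₀ 1) (z₀ (-1)) (fun k => e (0, true, k)) (fun k => e (0, false, k))
      (fun k => e' (0, true, k)) (fun k => e' (0, false, k)) (e (0, true, 0) - e' (0, true, 0)) 0
      (walk w I z₀ e) (walk w I z₀ e') where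
  pos := hw
  mono := hmono
  path := isPath_walk ..
  path' := isPath_walk ..
  rule := clockRule_walk hw hI
  rule' := clockRule_walk hw hI
  R_nonneg _ := he _
  R'_nonneg _ := he' _
  L_nonneg _ := he _
  L'_nonneg _ := he' _
  R_le k := by
    rcases k with _ | k
    · exact hlt.le
    · exact (heq _ (by simp)).le
  L_le k := (heq _ (by simp)).ge
  d_le := by simp
  e_le := by rw [heq _ (by simp), add_zero]
  d_nonneg := by linarith
  e_nonneg := le_rfl
  add_pos := by linarith
  arrow := by
    -- At the same site and rank both paths read the same clocks, the only modified one being at the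
    -- origin. The order of the visits lowers the left side of the race inequality and raises its
    -- right side.
    intro n n' hp h0 hv hr hl hright
    rw [← winsRight_iff] at hright ⊢
    unfold WinsRight at hright ⊢
    have hp0 : walk w I z₀ e' n' ≠ 0 := hp ▸ h0
    rw [walkClocks_of_ne_zero n h0, walkClocks_of_ne_zero n h0] at hright
    rw [walkClocks_of_ne_zero n' hp0, walkClocks_of_ne_zero n' hp0, heq _ (by simp [hp0]),
      heq _ (by simp [hp0]), ← hp, ← hv]
    have h1 : siteWeight w I (walkTimes w I z₀ e n) (walk w I z₀ e n + 1) ≤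
        siteWeight w I (walkTimes w I z₀ e' n') (walk w I z₀ e n + 1) := by
      refine siteWeight_mono hmono ?_
      rw [walkTimes_of_ne (by omega), walkTimes_of_ne (by omega)]
      omega
    have h2 : siteWeight w I (walkTimes w I z₀ e' n') (walk w I z₀ e n - 1) ≤
        siteWeight w I (walkTimes w I z₀ e n) (walk w I z₀ e n - 1) := by
      refine siteWeight_mono hmono ?_
      rw [walkTimes_of_ne (by omega), walkTimes_of_ne (by omega)]
      omega
    exact (mul_le_mul_of_nonneg_left h2 (he _)).trans_lt
      (hright.trans_le (mul_le_mul_of_nonneg_left h1 (he _)))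

end Walk

/-! ### Averages of the clocks -/

theorem integrable_id_expMeasure : Integrable (fun x : ℝ => x) (expMeasure 1) := by
  refine ⟨measurable_id.aestronglyMeasurable, ?_⟩
  have h1 := lintegral_exp_neg_mul (c := -(1 / 2)) (by norm_num)
  -- From `1 + y ≤ exp y` at `y = x / 2`; the bound has finite integral by the exponential moment
  -- above.
  have h2 : ∀ᵐ x ∂expMeasure 1, ‖x‖ₑ ≤ 2 * ENNReal.ofReal (Real.exp (-(x * -(1 / 2)))) := by
    filter_upwards [ae_pos_expMeasure] with x hx
    rw [← ofReal_norm, Real.norm_of_nonneg hx.le,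
      show (2 : ENNReal) = ENNReal.ofReal 2 by simp, ← ENNReal.ofReal_mul (by norm_num)]
    refine ENNReal.ofReal_le_ofReal ?_
    have := Real.add_one_le_exp (-(x * -(1 / 2)))
    linarith
  refine (lintegral_mono_ae h2).trans_lt ?_
  rw [lintegral_const_mul _ (by fun_prop), h1]
  exact ENNReal.mul_lt_top (by simp) ENNReal.ofReal_lt_top

/-- By the strong law of large numbers the averages converge, hence are bounded. An integer `C`
makes the event a countable union, which keeps it measurable. -/
theorem ae_exists_sum_le (s : Bool) : ∀ᵐ e ∂clockLaw ClockIndex,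
    ∃ C : ℕ, ∀ m : ℕ, ∑ i ∈ Finset.range m, e (0, s, i) ≤ (C : ℝ) * m := by
  have hmp : ∀ i : ClockIndex, MeasurePreserving (fun e : ClockIndex → ℝ => e i)
      (clockLaw ClockIndex) (expMeasure 1) := fun i =>
    measurePreserving_eval_infinitePi (fun _ : ClockIndex => expMeasure 1) i
  have hid : ∀ i j : ClockIndex, IdentDistrib (fun e : ClockIndex → ℝ => e i)
      (fun e : ClockIndex → ℝ => e j) (clockLaw ClockIndex) (clockLaw ClockIndex) := fun i j =>
    ⟨(hmp i).measurable.aemeasurable, (hmp j).measurable.aemeasurable,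
      (hmp i).map_eq.trans (hmp j).map_eq.symm⟩
  have hind : iIndepFun (fun (i : ClockIndex) (e : ClockIndex → ℝ) => e i)
      (clockLaw ClockIndex) :=
    iIndepFun_infinitePi (P := fun _ : ClockIndex => expMeasure 1) (X := fun _ x => x)
      fun _ => measurable_id
  have hint : Integrable (fun e : ClockIndex → ℝ => e (0, s, 0)) (clockLaw ClockIndex) :=
    (hmp _).integrable_comp_of_integrable integrable_id_expMeasure
  filter_upwards [strong_law_ae_real (fun (k : ℕ) (e : ClockIndex → ℝ) => e (0, s, k)) hint
    (fun i j hij => hind.indepFun (by simpa using hij)) (fun i => hid _ _)] with e he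
  obtain ⟨B, hB⟩ := he.bddAbove_range
  obtain ⟨C, hC⟩ := exists_nat_ge B
  refine ⟨C, fun m => ?_⟩
  rcases Nat.eq_zero_or_pos m with rfl | hm
  · simp
  · have := (hB ⟨m, rfl⟩).trans hC
    rwa [div_le_iff₀ (by exact_mod_cast hm)] at this

/-! ### The limit of the difference of the potentials -/

/-- The paths which visit the origin infinitely often and along which the difference of the
potentials at both neighbours of the origin converges to `δ`. -/
def limitEvent (w : ℕ → ℝ) (z₀ : ℤ → ℕ) (δ : ℝ) : Set (ℕ → ℤ) :=
  {p | Tendsto (fun n => ∑ k ∈ Finset.range (z₀ 1 + visits p n 1), 1 / w k -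
      ∑ k ∈ Finset.range (z₀ (-1) + visits p n (-1)), 1 / w k) atTop (𝓝 δ) ∧
    Tendsto (fun n => visits p n 0) atTop atTop}

theorem measurable_visits (n : ℕ) (x : ℤ) : Measurable fun p : ℕ → ℤ => visits p n x := by
  induction n with
  | zero => simp only [visits_zero]; exact measurable_const
  | succ n ih =>
    simp only [visits_succ]
    have h : MeasurableSet {p : ℕ → ℤ | p n = x} :=
      measurable_pi_apply (X := fun _ : ℕ => ℤ) n (measurableSet_singleton x)
    exact ih.add (Measurable.ite h measurable_const measurable_const)

theorem measurableSet_limitEvent (w : ℕ → ℝ) (z₀ : ℤ → ℕ) (δ : ℝ) :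
    MeasurableSet (limitEvent w z₀ δ) := by
  refine MeasurableSet.inter ?_ ?_
  · refine measurableSet_tendsto _ fun n => Measurable.sub ?_ ?_
    · exact (measurable_of_countable fun m => ∑ k ∈ Finset.range (z₀ 1 + m), 1 / w k).comp
        (measurable_visits n 1)
    · exact (measurable_of_countable fun m => ∑ k ∈ Finset.range (z₀ (-1) + m), 1 / w k).comp
        (measurable_visits n (-1))
  · exact measurableSet_tendsto _ fun n => measurable_visits n 0

variable {w : ℕ → ℝ} {I : Set ℤ} {z₀ : ℤ → ℕ}

/-- All clocks but the first one for the jumps from the origin to the right being fixed, the limit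
is equal to `δ` for at most one value of this clock. -/
theorem update_eq_of_mem_limitEvent (hw : ∀ n, 0 < w n) (hmono : Monotone w)
    (hdiv : ¬Summable fun n => 1 / w n) (hI : Walkable I) {δ : ℝ} {e e' : ClockIndex → ℝ}
    (he : ∀ i, 0 < e i) (he' : ∀ i, 0 < e' i) (heq : ∀ i, i ≠ (0, true, 0) → e' i = e i)
    {C : ℕ} (hC : ∀ m : ℕ, ∑ i ∈ Finset.range m, e (0, false, i) ≤ (C : ℝ) * m)
    (h : walk w I z₀ e ∈ limitEvent w z₀ δ) (h' : walk w I z₀ e' ∈ limitEvent w z₀ δ) :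
    ¬e' (0, true, 0) < e (0, true, 0) := by
  intro hlt
  have ht : Tendsto (fun n => ∑ k ∈ Finset.range n, 1 / w k) atTop atTop :=
    (not_summable_iff_tendsto_nat_atTop_of_nonneg fun n => (one_div_pos.2 (hw n)).le).1 hdiv
  exact (coupled_walk hw hmono hI (fun i => (he i).le) (fun i => (he' i).le) hlt
    heq).not_both_tendsto (sub_pos.2 hlt) ht hC h.2 h'.2 h.1 h'.1

theorem clockLaw_limitEvent (hw : ∀ n, 0 < w n) (hmono : Monotone w)
    (hdiv : ¬Summable fun n => 1 / w n) (hI : Walkable I) (δ : ℝ) :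
    ∀ᵐ e ∂clockLaw ClockIndex, walk w I z₀ e ∉ limitEvent w z₀ δ := by
  -- The event is intersected with the two almost sure properties of the clocks that the coupling
  -- uses.
  set S : Set (ClockIndex → ℝ) := {e | walk w I z₀ e ∈ limitEvent w z₀ δ ∧ (∀ i, 0 < e i) ∧
    ∃ C : ℕ, ∀ m : ℕ, ∑ i ∈ Finset.range m, e (0, false, i) ≤ (C : ℝ) * m} with hS
  have hSm : MeasurableSet S := by
    refine (measurable_walk w I z₀ (measurableSet_limitEvent w z₀ δ)).inter (.inter ?_ ?_)
    · have : {e : ClockIndex → ℝ | ∀ i, 0 < e i} = ⋂ i, {e | 0 < e i} := by ext; simp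
      change MeasurableSet {e : ClockIndex → ℝ | ∀ i, 0 < e i}
      rw [this]
      exact .iInter fun i => measurableSet_lt measurable_const (measurable_pi_apply i)
    · change MeasurableSet {e : ClockIndex → ℝ | ∃ C : ℕ, ∀ m : ℕ,
        ∑ i ∈ Finset.range m, e (0, false, i) ≤ (C : ℝ) * m}
      have : {e : ClockIndex → ℝ | ∃ C : ℕ, ∀ m : ℕ,
          ∑ i ∈ Finset.range m, e (0, false, i) ≤ (C : ℝ) * m} = ⋃ C : ℕ, ⋂ m : ℕ,
          {e | ∑ i ∈ Finset.range m, e (0, false, i) ≤ (C : ℝ) * m} := by ext; simp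
      rw [this]
      exact .iUnion fun C => .iInter fun m => measurableSet_le
        (Finset.measurable_fun_sum _ fun i _ => measurable_pi_apply _) measurable_const
  have hae : ∀ᵐ e ∂clockLaw ClockIndex, e ∉ S := by
    refine ae_clockLaw_of_update ((0, true, 0) : ClockIndex) hSm.compl fun e => ?_
    -- A slice in the first right clock contains at most one point of `S`, and a point is null for
    -- the exponential law.
    by_cases hex : ∃ u, Function.update e (0, true, 0) u ∈ S
    · obtain ⟨u, hu⟩ := hex
      have hne : ∀ᵐ v ∂expMeasure 1, v ≠ u := by
        rw [ae_iff]
        simp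
      filter_upwards [hne] with v hv hvS
      have key : ∀ {a b : ℝ}, Function.update e (0, true, 0) a ∈ S →
          Function.update e (0, true, 0) b ∈ S → ¬b < a := by
        intro a b ha hb
        obtain ⟨C, hC⟩ := ha.2.2
        have := update_eq_of_mem_limitEvent hw hmono hdiv hI ha.2.1 hb.2.1
          (fun i hi => by rw [Function.update_of_ne hi, Function.update_of_ne hi]) hC ha.1 hb.1
        simpa using this
      exact hv (le_antisymm (not_lt.1 (key hvS hu)) (not_lt.1 (key hu hvS)))
    · push Not at hex
      exact Eventually.of_forall hex
  filter_upwards [hae, ae_all_iff.2 fun i => ae_clockLaw_pos i, ae_exists_sum_le false]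
    with e h1 h2 h3 h4
  exact h1 ⟨h4, h2, h3⟩

theorem walkable_interval {a : WithBot ℤ} {b : WithTop ℤ} (ha : a < ((0 : ℤ) : WithBot ℤ))
    (hb : ((0 : ℤ) : WithTop ℤ) < b) : Walkable (interval a b) := by
  have key : ∀ x : ℤ, x ∈ interval a b ↔
      (∀ a' : ℤ, a = a' → a' ≤ x) ∧ ∀ b' : ℤ, b = b' → x ≤ b' := by
    intro x
    induction a using WithBot.recBotCoe <;> induction b using WithTop.recTopCoe <;>
      simp [interval]
  have ha' : ∀ a' : ℤ, a = a' → a' < 0 := by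
    rintro a' rfl
    exact WithBot.coe_lt_coe.1 ha
  have hb' : ∀ b' : ℤ, b = b' → 0 < b' := by
    rintro b' rfl
    exact WithTop.coe_lt_coe.1 hb
  constructor
  · rw [key]
    exact ⟨fun a' h => by have := ha' a' h; omega, fun b' h => by have := hb' b' h; omega⟩
  · rw [key]
    exact ⟨fun a' h => by have := ha' a' h; omega, fun b' h => by have := hb' b' h; omega⟩
  · rw [key]
    exact ⟨fun a' h => by have := ha' a' h; omega, fun b' h => by have := hb' b' h; omega⟩
  · intro x hx
    rw [key] at hx
    rcases le_or_gt x 0 with h0 | h0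
    · left
      rw [key]
      exact ⟨fun a' h => by have := hx.1 a' h; omega, fun b' h => by have := hb' b' h; omega⟩
    · right
      rw [key]
      exact ⟨fun a' h => by have := ha' a' h; omega, fun b' h => by have := hx.2 b' h; omega⟩

theorem localTime_eq_visits {Ω : Type*} (z₀ : ℤ → ℕ) (X : ℕ → Ω → ℤ) (n : ℕ) (y : ℤ) (ω : Ω) :
    localTime z₀ X n y ω = z₀ y + visits (fun n => X n ω) (n + 1) y := by
  rw [localTime, visits, Nat.count_eq_card_filter_range, Finset.sum_boole, Nat.cast_id]

end VRRW

theorem mainTheorem8 {Ω : Type*} [MeasurableSpace Ω] (P : Measure Ω) [IsProbabilityMeasure P]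
    (w : ℕ → ℝ) (hw_pos : ∀ n, 0 < w n) (hw_mono : Monotone w)
    (hw_sq : Summable fun n => 1 / w n ^ 2) (hw_div : ¬ Summable fun n => 1 / w n)
    (a : WithBot ℤ) (b : WithTop ℤ) (ha : a < ((0 : ℤ) : WithBot ℤ))
    (hb : ((0 : ℤ) : WithTop ℤ) < b)
    (z₀ : ℤ → ℕ) (X : ℕ → Ω → ℤ) (hX : VRRW.IsVRRW P w z₀ (VRRW.interval a b) X) (δ₀ : ℝ) :
    P {ω | Tendsto (fun n => VRRW.W w (VRRW.localTime z₀ X n 1 ω) -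
          VRRW.W w (VRRW.localTime z₀ X n (-1) ω)) atTop (𝓝 δ₀) ∧
        Tendsto (fun n => VRRW.localTime z₀ X n 0 ω) atTop atTop} = 0 := by
  have hI := VRRW.walkable_interval ha hb
  have hXm : Measurable fun ω n => X n ω :=
    measurable_pi_lambda _ fun k => (hX.stronglyMeasurable k).measurable
  have hsub : {ω | Tendsto (fun n => VRRW.W w (VRRW.localTime z₀ X n 1 ω) -
          VRRW.W w (VRRW.localTime z₀ X n (-1) ω)) atTop (𝓝 δ₀) ∧
        Tendsto (fun n => VRRW.localTime z₀ X n 0 ω) atTop atTop} ⊆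
      (fun ω n => X n ω) ⁻¹' VRRW.limitEvent w z₀ δ₀ := by
    rintro ω ⟨h1, h2⟩
    simp only [VRRW.localTime_eq_visits, VRRW.W_natCast] at h1 h2
    constructor
    · exact (tendsto_add_atTop_iff_nat 1).1 h1
    -- The local time at `n` is `z₀` plus the visits before `n + 1`; the constant is subtracted and
    -- the index shifted.
    · refine (tendsto_add_atTop_iff_nat 1).1 ?_
      simpa [Function.comp_def] using (tendsto_sub_atTop_nat (z₀ 0)).comp h2
  refine measure_mono_null hsub ?_
  rw [← Measure.map_apply hXm (VRRW.measurableSet_limitEvent w z₀ δ₀), hX.map_eq hw_pos hI,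
    Measure.map_apply (VRRW.measurable_walk w _ z₀) (VRRW.measurableSet_limitEvent w z₀ δ₀)]
  exact measure_eq_zero_iff_ae_notMem.2 (VRRW.clockLaw_limitEvent (z₀ := z₀) hw_pos hw_mono hw_div hI δ₀)
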